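/- **Setting.** Let $d\ge 1$. For every finite box ($d$-parallelepiped) $\Lambda=\{n\in\mathbb Z^d: a\le n\le b\}\neq\emptyset$ let $(J'_X)_{\emptyset\ne X\subseteq\Lambda}$ be independent centered Gaussian random variables with variances $\Delta_X^2\ge 0$, let $\mu'_X$ be real numbers, let $\mu\in\mathbb R$, and put $J_X=J'_X+\mu\mu'_X$. (All these data may depend on $\Lambda$; $\Delta_X=0$ is allowed; couplings that do not depend on $\Lambda$ and are translation invariant in distribution are a special case.) For $\sigma\in\{-1,1\}^\Lambda$ put $\sigma_X=\prod_{i\in X}\sigma_i$ and $$H_\Lambda(\sigma)=-\sum_{\emptyset\neq X\subseteq\Lambda}J_X\sigma_X .$$ Let $\mathrm{Av}$ be the expectation over the couplings, $\mathcal B_\Lambda(\sigma)=\mathrm{Av}(H_\Lambda(\sigma))$, $\mathcal C_\Lambda(\sigma,\tau)=\mathrm{Av}\big([H_\Lambda(\sigma)-\mathcal B_\Lambda(\sigma)][H_\Lambda(\tau)-\mathcal B_\Lambda(\tau)]\big)$, $b_\Lambda=\mathcal B_\Lambda/|\Lambda|$ and $c_\Lambda=\mathcal C_\Lambda/|\Lambda|$.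 The Hamiltonian is *thermodynamically stable* if there is $\bar c<\infty$ such that for all boxes $\Lambda$ $$\frac1{|\Lambda|}\sum_{\emptyset\ne X\subseteq\Lambda}|\mu\mu'_X|\le\bar c,\qquad \frac1{|\Lambda|}\sum_{\emptyset\ne X\subseteq\Lambda}\Delta_X^2\le\bar c .$$ For a function $O$ of $n$ replicas $\sigma^{(1)},\dots,\sigma^{(n)}$ put $$\langle O\rangle=\mathrm{Av}\Big(\sum_{\sigma^{(1)},\dots,\sigma^{(n)}}O\;\frac{e^{-\beta[H_\Lambda(\sigma^{(1)})+\dots+H_\Lambda(\sigma^{(n)})]}}{\mathcal Z(\beta)^n}\Big),\qquad \mathcal Z(\beta)=\sum_\sigma e^{-\beta H_\Lambda(\sigma)},$$ and $m_k=b_\Lambda(\sigma^{(k)})$, $q_{k,l}=c_\Lambda(\sigma^{(k)},\sigma^{(l)})$. Let $R\ge0$ be an integer and let $G=G(m,q)$ be a smooth ($C^\infty$) real function on $\mathbb R^R\times\mathbb R^{R\times R}$, evaluated at $m=(m_k)_{k\le R}$, $q=(q_{k,l})_{k,l\le R}$. (By thermodynamic stability $G(m,q)$ is bounded uniformly in $\Lambda$,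 $\beta$ and the replicas.) Define $$f_1(\beta,\mu)=\sum_{l=1}^R\langle(m_l-m_{R+1})G\rangle-\beta\Big\langle\sum_{\substack{k,l=1\\k\neq l}}^R G\,q_{l,k}-2R\,G\sum_{l=1}^R q_{l,R+1}+R(R+1)\,G\,q_{R+1,R+2}\Big\rangle ,$$ $$f_2(\beta,\mu)=\langle m_{R+1}G\rangle-\langle m_1\rangle\langle G\rangle-\beta\Big(\sum_{k=1}^{R+1}\langle G\,q_{k,R+1}\rangle-(R+1)\langle G\,q_{R+1,R+2}\rangle-\langle G\rangle\big(\langle q_{1,1}\rangle-\langle q_{1,2}\rangle\big)\Big).$$ **Theorem 1.** If the Hamiltonian is thermodynamically stable, then for every such $G$ and all real $\beta_1\le\beta_2$ the functions $\beta\mapsto f_i(\beta,\mu)$, $i=1,2$, are integrable on $[\beta_1,\beta_2]$ for every box $\Lambda$, and $$\lim_{\Lambda\nearrow\mathbb Z^d}\int_{\beta_1}^{\beta_2}|f_1(\beta,\mu)|\,d\beta=0,\qquad \lim_{\Lambda\nearrow\mathbb Z^d}\int_{\beta_1}^{\beta_2}|f_2(\beta,\mu)|\,d\beta=0,$$ where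 the limit is along the boxes of $\mathbb Z^d$ directed by inclusion. -/

import Mathlib

open MeasureTheory ProbabilityTheory Filter Topology
open scoped NNReal ContDiff

noncomputable section

namespace SpinGlass

/-- The sites of the lattice `ℤ^d`. -/
abbrev Site (d : ℕ) : Type := Fin d → ℤ

/-- The (nonempty, finite) `d`-parallelepipeds of `ℤ^d`, ordered by inclusion. -/
abbrev Box (d : ℕ) : Type :=
  {Λ : Finset (Site d) // ∃ a b : Site d, a ≤ b ∧ Λ = Finset.Icc a b}

/-- The volume `|Λ|`. -/
def Box.vol {d : ℕ} (Λ : Box d) : ℝ := (Λ.1.card : ℝ)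

/-- The nonempty subsets `X ⊆ Λ`. The empty set never contributes
(this is the convention `σ_∅ = 0`). -/
def interactionSets {d : ℕ} (Λ : Box d) : Finset (Finset (Site d)) := Λ.1.powerset.erase ∅

/-- Ising configurations `σ = (σ_n)_{n ∈ Λ}`, `σ_n = ±1`. -/
abbrev Config {d : ℕ} (Λ : Box d) : Type := {n : Site d // n ∈ Λ.1} → ℤˣ

/-- `σ_X = ∏_{i ∈ X} σ_i` for `X ⊆ Λ`. -/
def spinProd {d : ℕ} {Λ : Box d} (σ : Config Λ) (X : Finset (Site d)) : ℝ :=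
  ∏ i ∈ X.subtype (· ∈ Λ.1), (((σ i : ℤˣ) : ℤ) : ℝ)

/-- The partition function `Z(β) = ∑_σ exp(-β H(σ))` of an energy function `H`. -/
def partitionFn {d : ℕ} {Λ : Box d} (H : Config Λ → ℝ) (β : ℝ) : ℝ :=
  ∑ σ : Config Λ, Real.exp (-β * H σ)

/-- The `n`-fold product Gibbs-Boltzmann state of an energy function `H`, applied to a
function `O` of `n` replicas. -/
def gibbs {d : ℕ} {Λ : Box d} (n : ℕ) (H : Config Λ → ℝ) (β : ℝ)
    (O : (Fin n → Config Λ) → ℝ) : ℝ :=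
  ∑ σ : Fin n → Config Λ,
    O σ * (Real.exp (-β * ∑ k, H (σ k)) / partitionFn H β ^ n)

/-- Gaussian couplings. For each box `Λ` the centered parts `J'_X`, `∅ ≠ X ⊆ Λ`, are
independent Gaussian variables with mean `0` and variance `Δ_X²`, and `μ'_X` are the
undeformed means. All the data may depend on `Λ` (as in mean field models); a
`Λ`-independent interaction is the special case of functions constant in `Λ`. -/
structure Model (d : ℕ) {Ω : Type*} [MeasurableSpace Ω] (P : Measure Ω) where
  /-- the undeformed means `μ'_X` -/
  μ' : Box d → Finset (Site d) → ℝ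
  /-- the standard deviations `Δ_X` -/
  Δ : Box d → Finset (Site d) → ℝ≥0
  /-- the centered parts of the couplings -/
  J' : Box d → Finset (Site d) → Ω → ℝ
  law : ∀ Λ, ∀ X ∈ interactionSets Λ, HasLaw (J' Λ X) (gaussianReal 0 (Δ Λ X ^ 2)) P
  indep : ∀ Λ, iIndepFun (fun X : {X // X ∈ interactionSets Λ} => J' Λ X.1) P

namespace Model

variable {d : ℕ} {Ω : Type*} [MeasurableSpace Ω] {P : Measure Ω}

/-- The couplings `J_X = J'_X + μ μ'_X`, with mean `μ_X = μ μ'_X`. -/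
def coupling (M : Model d P) (μ : ℝ) (Λ : Box d) (X : Finset (Site d)) (w : Ω) : ℝ :=
  M.J' Λ X w + μ * M.μ' Λ X

/-- The Hamiltonian `H_Λ(σ) = -∑_{X ⊆ Λ} J_X σ_X`. -/
def hamiltonian (M : Model d P) (μ : ℝ) (Λ : Box d) (w : Ω) (σ : Config Λ) : ℝ :=
  -∑ X ∈ interactionSets Λ, M.coupling μ Λ X w * spinProd σ X

/-- Thermodynamic stability of the Hamiltonian with coupling means `μ_X = μ μ'_X` and
coupling variances `Δ_X²`. -/
def ThermodynamicallyStable (M : Model d P) (μ : ℝ) : Prop :=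
  ∃ c : ℝ, ∀ Λ : Box d,
    1 / Λ.vol * ∑ X ∈ interactionSets Λ, |μ * M.μ' Λ X| ≤ c ∧
    1 / Λ.vol * ∑ X ∈ interactionSets Λ, (M.Δ Λ X : ℝ) ^ 2 ≤ c

/-- The average `B_Λ(σ) = Av(H_Λ(σ))`. -/
def meanH (M : Model d P) (μ : ℝ) (Λ : Box d) (σ : Config Λ) : ℝ :=
  ∫ w, M.hamiltonian μ Λ w σ ∂P

/-- The covariance matrix
`C_Λ(σ,τ) = Av([H_Λ(σ) - B_Λ(σ)] [H_Λ(τ) - B_Λ(τ)])`. -/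
def covH (M : Model d P) (μ : ℝ) (Λ : Box d) (σ τ : Config Λ) : ℝ :=
  ∫ w, (M.hamiltonian μ Λ w σ - M.meanH μ Λ σ) *
    (M.hamiltonian μ Λ w τ - M.meanH μ Λ τ) ∂P

/-- The generalized magnetization `m_k = b_Λ(σ^(k)) = B_Λ(σ^(k)) / |Λ|`. -/
def mag (M : Model d P) (μ : ℝ) (Λ : Box d) {n : ℕ} (k : Fin n)
    (σ : Fin n → Config Λ) : ℝ :=
  1 / Λ.vol * M.meanH μ Λ (σ k)

/-- The generalized overlap `q_{k,l} = c_Λ(σ^(k),σ^(l)) = C_Λ(σ^(k),σ^(l)) / |Λ|`. -/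
def overlap (M : Model d P) (μ : ℝ) (Λ : Box d) {n : ℕ} (k l : Fin n)
    (σ : Fin n → Config Λ) : ℝ :=
  1 / Λ.vol * M.covH μ Λ (σ k) (σ l)

/-- The quenched equilibrium state `⟨O⟩ = Av(Ω(O))` for a function `O` of `n` replicas. -/
def quenched (M : Model d P) (β μ : ℝ) (Λ : Box d) {n : ℕ}
    (O : (Fin n → Config Λ) → ℝ) : ℝ :=
  ∫ w, gibbs n (M.hamiltonian μ Λ w) β O ∂P

/-- The observable `G(m,q)`, a function of the magnetizations and overlaps of the replicas
`1, …, R`, seen as a function of the replicas `1, …, R + 2`. -/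
def observable (M : Model d P) (μ : ℝ) (Λ : Box d) {R : ℕ}
    (G : (Fin R → ℝ) × (Fin R → Fin R → ℝ) → ℝ) (σ : Fin (R + 2) → Config Λ) : ℝ :=
  G (fun k => M.mag μ Λ (Fin.castAdd 2 k) σ,
     fun k l => M.overlap μ Λ (Fin.castAdd 2 k) (Fin.castAdd 2 l) σ)

/-- The function `f₁(β,μ)` in the volume `Λ`. Replica `l ≤ R` is `Fin.castAdd 2 l`,
replicas `R + 1` and `R + 2` are `Fin.natAdd R 0` and `Fin.natAdd R 1`. -/
def f₁ (M : Model d P) {R : ℕ} (G : (Fin R → ℝ) × (Fin R → Fin R → ℝ) → ℝ)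
    (Λ : Box d) (β μ : ℝ) : ℝ :=
  let g : (Fin (R + 2) → Config Λ) → ℝ := M.observable μ Λ G
  let m : Fin (R + 2) → (Fin (R + 2) → Config Λ) → ℝ := fun k => M.mag μ Λ k
  let q : Fin (R + 2) → Fin (R + 2) → (Fin (R + 2) → Config Λ) → ℝ :=
    fun k l => M.overlap μ Λ k l
  let r : Fin R → Fin (R + 2) := Fin.castAdd 2
  let r₁ : Fin (R + 2) := Fin.natAdd R (0 : Fin 2)
  let r₂ : Fin (R + 2) := Fin.natAdd R (1 : Fin 2)
  (∑ l : Fin R, M.quenched β μ Λ (fun σ => (m (r l) σ - m r₁ σ) * g σ))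
    - β * M.quenched β μ Λ (fun σ =>
        (∑ k : Fin R, ∑ l : Fin R, if k ≠ l then g σ * q (r l) (r k) σ else 0)
          - 2 * (R : ℝ) * g σ * ∑ l : Fin R, q (r l) r₁ σ
          + (R : ℝ) * ((R : ℝ) + 1) * g σ * q r₁ r₂ σ)

/-- The function `f₂(β,μ)` in the volume `Λ`. Replicas `R + 1` and `R + 2` are
`Fin.natAdd R 0` and `Fin.natAdd R 1`; replicas `1` and `2` are `0` and `1`. -/
def f₂ (M : Model d P) {R : ℕ} (G : (Fin R → ℝ) × (Fin R → Fin R → ℝ) → ℝ)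
    (Λ : Box d) (β μ : ℝ) : ℝ :=
  let g : (Fin (R + 2) → Config Λ) → ℝ := M.observable μ Λ G
  let m : Fin (R + 2) → (Fin (R + 2) → Config Λ) → ℝ := fun k => M.mag μ Λ k
  let q : Fin (R + 2) → Fin (R + 2) → (Fin (R + 2) → Config Λ) → ℝ :=
    fun k l => M.overlap μ Λ k l
  let r₁ : Fin (R + 2) := Fin.natAdd R (0 : Fin 2)
  let r₂ : Fin (R + 2) := Fin.natAdd R (1 : Fin 2)
  M.quenched β μ Λ (fun σ => m r₁ σ * g σ)
    - M.quenched β μ Λ (m 0) * M.quenched β μ Λ g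
    - β * ((∑ k : Fin (R + 1), M.quenched β μ Λ (fun σ => g σ * q k.castSucc r₁ σ))
        - ((R : ℝ) + 1) * M.quenched β μ Λ (fun σ => g σ * q r₁ r₂ σ)
        - M.quenched β μ Λ g *
            (M.quenched β μ Λ (q 0 0) - M.quenched β μ Λ (q 0 1)))

end Model

end SpinGlass

end

/-! Write N for the volume, H for the Hamiltonian and O = G(m,q). Gaussian integration by parts
turns ⟨H(σ^(l)) O⟩ into a mean term minus β times overlaps with the other replicas and with one
unused replica (`integral_replicaAvg_energy_embedding`). Read backwards, this identifies both
functions as energy comparisons: N f₁ is the sum over l ≤ R of ⟨H(σ^(l)) O⟩ − ⟨H(σ^(R+1)) O⟩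
(`Model.f₁_eq`), and N f₂ is ⟨H(σ^(R+1)) O⟩ − ⟨H⟩⟨O⟩ (`Model.f₂_eq`). Since O is bounded uniformly
in the box, it suffices that the energy fluctuates by o(N), on average over β.

For fixed couplings two replicas share the same Gibbs mean energy, so f₁ sees thermal fluctuations
only. The Gibbs variance of H is minus the β-derivative of the mean energy, so its β-integral is a
difference of two quenched energies, which is O(N); the mean absolute deviation then integrates to
O(N^(1/2)) (`integral_gibbsAbsDev_le`).

For f₂ the Gibbs energy must also be compared with its average over the couplings
(`integral_abs_gibbsEnergy_sub_le`). The logarithm of the partition function is convex in β with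
slope minus the Gibbs energy, and it has variance O(N) because it is Lipschitz in each independent
coupling (`integral_sub_sq_le_sum`). Comparing difference quotients of step δ for the random and the
averaged pressure bounds the integrated deviation by δ⁻¹ O(N^(1/2)) + δ O(N). The choice δ =
N^(-1/4) gives O(N^(3/4)), which is o(N). -/

noncomputable section

namespace SpinGlass

/-! ### Resampling one coordinate of a product measure -/

section Resampling

variable {ι : Type*} [Fintype ι] [DecidableEq ι]

/-- Resampling one coordinate of a random vector with independent coordinates does not change
its law. -/
theorem measurePreserving_update (ν : ι → Measure ℝ) [∀ i, IsProbabilityMeasure (ν i)] (i : ι) :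
    MeasurePreserving (fun p : (ι → ℝ) × ℝ => Function.update p.1 i p.2)
      ((Measure.pi ν).prod (ν i)) (Measure.pi ν) := by
  have hm : Measurable (fun p : (ι → ℝ) × ℝ => Function.update p.1 i p.2) := by
    refine measurable_pi_lambda _ fun j => ?_
    by_cases h : j = i
    · subst h; simpa using measurable_snd
    · simp only [Function.update_of_ne h]; fun_prop
  refine ⟨hm, ?_⟩
  symm
  refine Measure.pi_eq fun s hs => ?_
  rw [Measure.map_apply hm (MeasurableSet.univ_pi hs)]
  have hpre : (fun p : (ι → ℝ) × ℝ => Function.update p.1 i p.2) ⁻¹' (Set.univ.pi s)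
      = (Set.univ.pi (Function.update s i Set.univ)) ×ˢ (s i) := by
    ext ⟨x, t⟩
    simp only [Set.mem_preimage, Set.mem_pi, Set.mem_univ, true_imp_iff, Set.mem_prod]
    constructor
    · intro h
      refine ⟨fun j => ?_, by simpa using h i⟩
      by_cases hj : j = i
      · subst hj; simp
      · simpa [hj] using h j
    · rintro ⟨h, ht⟩ j
      by_cases hj : j = i
      · subst hj; simpa using ht
      · simpa [hj] using h j
  rw [hpre, Measure.prod_prod, Measure.pi_pi, ← Finset.mul_prod_erase _ _ (Finset.mem_univ i),
    ← Finset.mul_prod_erase _ (fun j => ν j (s j)) (Finset.mem_univ i)]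
  simp only [Function.update_self, measure_univ, one_mul]
  rw [mul_comm]
  congr 1
  refine Finset.prod_congr rfl fun j hj => ?_
  rw [Function.update_of_ne (Finset.ne_of_mem_erase hj)]

theorem integrable_comp_update {ν : ι → Measure ℝ} [∀ i, IsProbabilityMeasure (ν i)] (i : ι)
    {F : (ι → ℝ) → ℝ} (hF : Integrable F (Measure.pi ν)) :
    Integrable (fun p : (ι → ℝ) × ℝ => F (Function.update p.1 i p.2))
      ((Measure.pi ν).prod (ν i)) :=
  (measurePreserving_update ν i).integrable_comp_of_integrable hF

/-- Fubini in the coordinate i without splitting the product: the old value of x i is overwritten,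
so integrating over it in the outer integral is harmless. Both the integration by parts and the
variance bound reduce to one dimension through this identity. -/
theorem integral_eq_integral_update {ν : ι → Measure ℝ} [∀ i, IsProbabilityMeasure (ν i)] (i : ι)
    {F : (ι → ℝ) → ℝ} (hF : Integrable F (Measure.pi ν)) :
    ∫ x, F x ∂Measure.pi ν = ∫ x, ∫ t, F (Function.update x i t) ∂ν i ∂Measure.pi ν := by
  rw [integral_integral (f := fun x t => F (Function.update x i t)) (integrable_comp_update i hF)]
  conv_lhs => rw [← (measurePreserving_update ν i).map_eq]
  refine integral_map (measurePreserving_update ν i).aemeasurable ?_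
  rw [(measurePreserving_update ν i).map_eq]
  exact hF.aestronglyMeasurable

end Resampling

/-! ### Gaussian integration by parts -/

section GaussianIntegrationByParts

theorem hasDerivAt_gaussianPDFReal (v : ℝ≥0) (x : ℝ) :
    HasDerivAt (gaussianPDFReal 0 v) (-(x / v) * gaussianPDFReal 0 v x) x := by
  have h : HasDerivAt (fun x : ℝ => -(x - 0) ^ 2 / (2 * (v : ℝ))) (-(x / v)) x := by
    have := (((hasDerivAt_id x).sub_const 0).pow 2).neg.div_const (2 * (v : ℝ))
    refine this.congr_deriv ?_
    simp
    rcases eq_or_ne (v : ℝ) 0 with h | h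
    -- Division by zero makes both derivatives vanish when v = 0, so no hypothesis on v is needed.
    · simp [h]
    · field_simp
  have := (h.exp).const_mul (√(2 * Real.pi * v))⁻¹
  refine (this.congr_deriv ?_)
  simp only [gaussianPDFReal]
  ring

/-- One-dimensional Gaussian integration by parts. -/
theorem integral_mul_gaussianReal (v : ℝ≥0) {f f' : ℝ → ℝ} {C : ℝ}
    (hf : ∀ x, HasDerivAt f (f' x) x) (hf' : Continuous f') (hfC : ∀ x, |f x| ≤ C)
    (hfC' : ∀ x, |f' x| ≤ C) :
    ∫ x, x * f x ∂gaussianReal 0 v = v * ∫ x, f' x ∂gaussianReal 0 v := by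
  have hfc : Continuous f := continuous_iff_continuousAt.2 fun x => (hf x).continuousAt
  -- Variance zero is the Dirac mass at 0, where both sides vanish; couplings with Δ_X = 0 are
  -- allowed, so the case does occur.
  rcases eq_or_ne v 0 with rfl | hv
  · simp [gaussianReal_zero_var]
  have hid : Integrable (fun x : ℝ => x) (gaussianReal 0 v) :=
    (memLp_id_gaussianReal (μ := 0) (v := v) 1).integrable le_rfl
  have hpdf : ∀ g : ℝ → ℝ, Integrable g (gaussianReal 0 v) →
      Integrable (fun x => g x * gaussianPDFReal 0 v x) := by
    intro g hg
    rw [gaussianReal_of_var_ne_zero _ hv, integrable_withDensity_iff (measurable_gaussianPDF _ _)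
      (by simp [gaussianPDF_lt_top])] at hg
    simpa [toReal_gaussianPDF] using hg
  have hv' : (v : ℝ) ≠ 0 := by exact_mod_cast hv
  have hbf : Integrable f (gaussianReal 0 v) :=
    Integrable.of_bound hfc.aestronglyMeasurable C (ae_of_all _ hfC)
  have hbf' : Integrable f' (gaussianReal 0 v) :=
    Integrable.of_bound hf'.aestronglyMeasurable C (ae_of_all _ hfC')
  have hxf : Integrable (fun x => x * f x) (gaussianReal 0 v) :=
    hid.mul_bdd hfc.aestronglyMeasurable (ae_of_all _ hfC)
  -- Integrability of the three products over the whole line replaces the vanishing of the boundary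
  -- terms at infinity.
  have key := integral_mul_deriv_eq_deriv_mul_of_integrable (u := f) (u' := f')
    (v := gaussianPDFReal 0 v) (v' := fun x => -(x / v) * gaussianPDFReal 0 v x)
    (fun x _ => hf x) (fun x _ => hasDerivAt_gaussianPDFReal v x)
    (((hpdf _ hxf).const_mul (-(v : ℝ)⁻¹)).congr (ae_of_all _ fun x => by
      simp only [Pi.mul_apply]; ring))
    (hpdf _ hbf') (hpdf _ hbf)
  rw [integral_gaussianReal_eq_integral_smul hv, integral_gaussianReal_eq_integral_smul hv]
  have h1 : ∫ x, f x * (-(x / v) * gaussianPDFReal 0 v x)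
      = -(v : ℝ)⁻¹ * ∫ x, gaussianPDFReal 0 v x • (x * f x) := by
    rw [← integral_const_mul]
    congr 1; ext x; simp only [smul_eq_mul]; ring
  have h2 : ∫ x, f' x * gaussianPDFReal 0 v x = ∫ x, gaussianPDFReal 0 v x • f' x := by
    congr 1; ext x; simp only [smul_eq_mul]; ring
  rw [h1, h2] at key
  field_simp at key
  linarith

variable {ι : Type*} [Fintype ι]

/-- The law of independent centered Gaussian variables with variances `v i`. -/
def gaussianPi (v : ι → ℝ≥0) : Measure (ι → ℝ) := Measure.pi fun i => gaussianReal 0 (v i)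

instance (v : ι → ℝ≥0) : IsProbabilityMeasure (gaussianPi v) := by
  unfold gaussianPi; infer_instance

theorem memLp_eval_gaussianPi (v : ι → ℝ≥0) (i : ι) :
    MemLp (fun x : ι → ℝ => x i) 2 (gaussianPi v) :=
  (memLp_id_gaussianReal (μ := 0) (v := v i) 2).comp_measurePreserving
    (measurePreserving_eval (fun i => gaussianReal 0 (v i)) i)

/-- Energies grow at most linearly in the couplings, so this function serves as the common envelope,
and its square dominates the Gibbs variance. -/
theorem memLp_const_add_sum_abs_gaussianPi (v : ι → ℝ≥0) (A : ℝ) :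
    MemLp (fun x : ι → ℝ => A + ∑ i, |x i|) 2 (gaussianPi v) :=
  (memLp_const A).add (memLp_finsetSum _ fun i _ => (memLp_eval_gaussianPi v i).abs)

theorem integrable_of_continuous_of_le_mul_const_add_sum_abs (v : ι → ℝ≥0) {A K : ℝ}
    {F : (ι → ℝ) → ℝ} (hF : Continuous F) (hle : ∀ x, |F x| ≤ K * (A + ∑ i, |x i|)) :
    Integrable F (gaussianPi v) :=
  (((memLp_const_add_sum_abs_gaussianPi v A).integrable one_le_two).const_mul K).mono'
    hF.aestronglyMeasurable (ae_of_all _ hle)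

/-- Gaussian integration by parts for independent Gaussian variables. -/
theorem integral_eval_mul_gaussianPi [DecidableEq ι] (v : ι → ℝ≥0) (i : ι) {F F' : (ι → ℝ) → ℝ}
    {C : ℝ} (hF : Continuous F) (hF' : Continuous F')
    (hd : ∀ x t, HasDerivAt (fun t => F (Function.update x i t)) (F' (Function.update x i t)) t)
    (hFC : ∀ x, |F x| ≤ C) (hFC' : ∀ x, |F' x| ≤ C) :
    ∫ x, x i * F x ∂gaussianPi v = v i * ∫ x, F' x ∂gaussianPi v := by
  have h1 : Integrable (fun x => x i * F x) (gaussianPi v) :=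
    ((memLp_eval_gaussianPi v i).integrable one_le_two).mul_bdd hF.aestronglyMeasurable
      (ae_of_all _ hFC)
  have h2 : Integrable F' (gaussianPi v) :=
    Integrable.of_bound hF'.aestronglyMeasurable C (ae_of_all _ hFC')
  unfold gaussianPi at *
  rw [integral_eq_integral_update i h1, integral_eq_integral_update i h2, ← integral_const_mul]
  congr 1; ext x
  -- After resampling, the factor x i is the inner integration variable, and the inner integral is
  -- the one-dimensional formula.
  simp only [Function.update_self]
  exact integral_mul_gaussianReal (v i) (hd x) (by fun_prop) (fun t => hFC _) (fun t => hFC' _)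

end GaussianIntegrationByParts

/-! ### Variance of Lipschitz functions of independent Gaussians -/

section VarianceBound

variable {ι : Type*} [Fintype ι]

/-- Centring at f 0 instead of the mean can only increase the second moment, and f t − f 0 is at
most L|t| in absolute value. -/
theorem integral_sub_integral_sq_le {v : ℝ≥0} {f : ℝ → ℝ} {L : ℝ}
    (hf : ∀ s t, |f s - f t| ≤ L * |s - t|) (hfc : Continuous f) :
    ∫ t, (f t - ∫ s, f s ∂gaussianReal 0 v) ^ 2 ∂gaussianReal 0 v ≤ L ^ 2 * v := by
  have hid : MemLp (fun t : ℝ => t) 2 (gaussianReal 0 v) := memLp_id_gaussianReal 2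
  have hdiff : MemLp (fun t => f t - f 0) 2 (gaussianReal 0 v) := by
    refine (hid.const_mul L).of_le (by fun_prop) (ae_of_all _ fun t => ?_)
    have := hf t 0
    rw [sub_zero] at this
    rw [Real.norm_eq_abs, Real.norm_eq_abs, abs_mul]
    exact this.trans (mul_le_mul_of_nonneg_right (le_abs_self L) (abs_nonneg _))
  have hmem : MemLp f 2 (gaussianReal 0 v) := by
    have := hdiff.add (memLp_const (f 0))
    refine this.ae_eq (ae_of_all _ fun t => by simp)
  rw [← variance_eq_integral hmem.aemeasurable, ← variance_sub_const hmem.aestronglyMeasurable (f 0)]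
  refine (variance_le_expectation_sq hdiff.aestronglyMeasurable).trans ?_
  have hv : ∫ t, t ^ 2 ∂gaussianReal 0 v = v := by
    have := variance_fun_id_gaussianReal (μ := 0) (v := v)
    rw [variance_of_integral_eq_zero (by fun_prop) (by simp [integral_id_gaussianReal])] at this
    exact this
  calc ∫ t, ((fun t => f t - f 0) ^ 2) t ∂gaussianReal 0 v
      ≤ ∫ t, L ^ 2 * t ^ 2 ∂gaussianReal 0 v := by
        refine integral_mono hdiff.integrable_sq (hid.integrable_sq.const_mul _) fun t => ?_
        have := hf t 0
        rw [sub_zero] at this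
        simp only [Pi.pow_apply]
        rw [← sq_abs, ← sq_abs t, ← mul_pow]
        exact pow_le_pow_left₀ (abs_nonneg _) this 2
    _ = L ^ 2 * v := by rw [integral_const_mul, hv]

theorem lipschitz_continuous_of_sum_abs {ι : Type*} {s : Finset ι} {f : (ι → ℝ) → ℝ} {L : ℝ}
    (hf : ∀ x y, |f x - f y| ≤ L * ∑ i ∈ s, |x i - y i|) : Continuous f := by
  rw [continuous_iff_continuousAt]
  intro x
  rw [ContinuousAt, tendsto_iff_dist_tendsto_zero]
  refine squeeze_zero (fun _ => dist_nonneg) (fun y => hf y x) ?_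
  have : Continuous fun y : ι → ℝ => L * ∑ i ∈ s, |y i - x i| := by fun_prop
  simpa using this.tendsto x

theorem memLp_of_sum_abs (v : ι → ℝ≥0) {s : Finset ι} {f : (ι → ℝ) → ℝ} {L : ℝ}
    (hf : ∀ x y, |f x - f y| ≤ L * ∑ i ∈ s, |x i - y i|) : MemLp f 2 (gaussianPi v) := by
  have hsum : MemLp (fun x : ι → ℝ => ∑ i ∈ s, |x i|) 2 (gaussianPi v) :=
    memLp_finsetSum _ fun i _ => (memLp_eval_gaussianPi v i).abs
  have hd : MemLp (fun x : ι → ℝ => f x - f 0) 2 (gaussianPi v) := by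
    have hL : MemLp (fun x : ι → ℝ => L * ∑ i ∈ s, |x i|) 2 (gaussianPi v) := hsum.const_mul L
    have hc : Continuous fun x : ι → ℝ => f x - f 0 :=
      (lipschitz_continuous_of_sum_abs hf).sub continuous_const
    refine hL.of_le hc.aestronglyMeasurable (ae_of_all _ fun x => ?_)
    have h := hf x 0
    simp only [Pi.zero_apply, sub_zero] at h
    exact h.trans (le_abs_self _)
  have hc : MemLp (fun _ : ι → ℝ => f 0) 2 (gaussianPi v) := memLp_const (f 0)
  exact (hd.add hc).ae_eq (ae_of_all _ fun x => by simp)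

/-- The tensorization of the variance: a function of independent centered Gaussian variables
that is `L`-Lipschitz in each of them has variance at most `L² ∑ᵢ vᵢ`. -/
theorem integral_sub_sq_le_sum (v : ι → ℝ≥0) (L : ℝ) (s : Finset ι) :
    ∀ f : (ι → ℝ) → ℝ, (∀ x y, |f x - f y| ≤ L * ∑ i ∈ s, |x i - y i|) →
      ∫ x, (f x - ∫ y, f y ∂gaussianPi v) ^ 2 ∂gaussianPi v ≤ L ^ 2 * ∑ i ∈ s, (v i : ℝ) := by
  classical
  -- The Lipschitz bound sums over s only, so it also says that f ignores the coordinates outside s.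
  -- Averaging over a coordinate removes it from s, and for s empty the function is constant.
  induction s using Finset.induction_on with
  | empty =>
    intro f hf
    have : ∀ x, f x = f 0 := fun x => by
      have := hf x 0
      simp only [Finset.sum_empty, mul_zero] at this
      exact sub_eq_zero.1 (abs_nonpos_iff.1 this)
    simp only [this]
    simp
  | insert i s his ih =>
    intro f hf
    -- g is the conditional expectation of f given all coordinates except i; it inherits the
    -- Lipschitz bound on s, so the induction hypothesis controls its variance.
    set g : (ι → ℝ) → ℝ := fun x => ∫ t, f (Function.update x i t) ∂gaussianReal 0 (v i) with hg
    have hfc := lipschitz_continuous_of_sum_abs hf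
    have hf2 := memLp_of_sum_abs v hf
    have hupd : ∀ x s t, |f (Function.update x i s) - f (Function.update x i t)| ≤ L * |s - t| := by
      intro x s' t
      refine (hf _ _).trans (le_of_eq ?_)
      rw [Finset.sum_insert his]
      have : ∑ j ∈ s, |Function.update x i s' j - Function.update x i t j| = 0 :=
        Finset.sum_eq_zero fun j hj => by
          have : j ≠ i := fun h => his (h ▸ hj)
          simp [this]
      rw [this]
      simp
    have hint : ∀ x, Integrable (fun t => f (Function.update x i t)) (gaussianReal 0 (v i)) := by
      intro x
      have hb : Integrable (fun t : ℝ => |f (Function.update x i 0)| + |L| * |t|)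
          (gaussianReal 0 (v i)) :=
        (integrable_const _).add
          (((memLp_id_gaussianReal (μ := 0) (v := v i) 1).integrable le_rfl).abs.const_mul _)
      refine hb.mono' (by fun_prop) (ae_of_all _ fun t => ?_)
      have h := hupd x t 0
      rw [sub_zero] at h
      have h1 : |f (Function.update x i t)| ≤ |f (Function.update x i 0)|
          + |f (Function.update x i t) - f (Function.update x i 0)| := by
        have := abs_add_le (f (Function.update x i 0))
          (f (Function.update x i t) - f (Function.update x i 0)); simpa using this
      have h2 := mul_le_mul_of_nonneg_right (le_abs_self L) (abs_nonneg t)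
      rw [Real.norm_eq_abs]
      linarith
    have hgl : ∀ x y, |g x - g y| ≤ L * ∑ i ∈ s, |x i - y i| := by
      intro x y
      simp only [hg]
      rw [← integral_sub (hint x) (hint y)]
      have hpt : ∀ t, ‖f (Function.update x i t) - f (Function.update y i t)‖
          ≤ L * ∑ i ∈ s, |x i - y i| := by
        intro t
        refine (hf _ _).trans (le_of_eq ?_)
        rw [Finset.sum_insert his]
        simp only [Function.update_self, sub_self, abs_zero, zero_add]
        congr 1
        refine Finset.sum_congr rfl fun j hj => ?_
        have : j ≠ i := fun h => his (h ▸ hj)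
        simp [this]
      simpa using norm_integral_le_of_norm_le_const (μ := gaussianReal 0 (v i)) (ae_of_all _ hpt)
    have hg2 := memLp_of_sum_abs v hgl
    have hgu : ∀ x t, g (Function.update x i t) = g x := by intro x t; simp [hg]
    have hfg : ∫ x, f x ∂gaussianPi v = ∫ x, g x ∂gaussianPi v :=
      integral_eq_integral_update i (hf2.integrable one_le_two)
    set m := ∫ x, g x ∂gaussianPi v with hm
    -- Orthogonality of the martingale increments: g − m does not depend on the coordinate i, and f
    -- − g has mean zero in it.
    have hcross : ∫ x, (f x - g x) * (g x - m) ∂gaussianPi v = 0 := by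
      have hi : Integrable (fun x => (f x - g x) * (g x - m)) (gaussianPi v) :=
        (hf2.sub hg2).integrable_mul (hg2.sub (memLp_const m))
      have h0 := integral_eq_integral_update i hi
      refine h0.trans ?_
      have : ∀ x, ∫ t, (f (Function.update x i t) - g (Function.update x i t))
          * (g (Function.update x i t) - m) ∂gaussianReal 0 (v i) = 0 := by
        intro x
        simp only [hgu]
        rw [integral_mul_const, integral_sub (hint x) (integrable_const _)]
        simp [hg]
      simp only [this, integral_zero]
    have hfirst : ∫ x, (f x - g x) ^ 2 ∂gaussianPi v ≤ L ^ 2 * v i := by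
      have hi : Integrable (fun x => (f x - g x) ^ 2) (gaussianPi v) :=
        (hf2.sub hg2).integrable_sq
      have h0 := integral_eq_integral_update i hi
      refine h0.le.trans ?_
      have hle : ∀ x, ∫ t, (f (Function.update x i t) - g (Function.update x i t)) ^ 2
          ∂gaussianReal 0 (v i) ≤ L ^ 2 * v i := by
        intro x
        simp only [hgu]
        exact integral_sub_integral_sq_le (hupd x) (by fun_prop)
      calc _ ≤ ∫ _, L ^ 2 * (v i : ℝ) ∂gaussianPi v :=
            integral_mono (integrable_comp_update i hi).integral_prod_left (integrable_const _) hle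
        _ = _ := by simp
    rw [hfg]
    have hexp : ∀ x, (f x - m) ^ 2
        = (f x - g x) ^ 2 + (2 * ((f x - g x) * (g x - m)) + (g x - m) ^ 2) := fun x => by ring
    simp only [hexp]
    have i1 : Integrable (fun x => (f x - g x) ^ 2) (gaussianPi v) :=
      (hf2.sub hg2).integrable_sq
    have i2 : Integrable (fun x => 2 * ((f x - g x) * (g x - m))) (gaussianPi v) :=
      ((hf2.sub hg2).integrable_mul (hg2.sub (memLp_const m))).const_mul 2
    have i3 : Integrable (fun x => (g x - m) ^ 2) (gaussianPi v) :=
      (hg2.sub (memLp_const m)).integrable_sq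
    have i4 : Integrable (fun x => 2 * ((f x - g x) * (g x - m)) + (g x - m) ^ 2)
        (gaussianPi v) := i2.add i3
    rw [integral_add i1 i4, integral_add i2 i3, integral_const_mul, hcross,
      Finset.sum_insert his, mul_add]
    have := ih g hgl
    linarith

end VarianceBound

/-! ### Gibbs weights on a finite set -/

section Softmax

variable {S : Type*} [Fintype S]

/-- The probability weights `exp (x σ) / ∑ τ, exp (x τ)`. -/
def softmax (x : S → ℝ) (σ : S) : ℝ := Real.exp (x σ) / ∑ τ, Real.exp (x τ)

/-- The expectation of `φ` under the weights `softmax x`. -/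
def softmaxAvg (x φ : S → ℝ) : ℝ := ∑ σ, softmax x σ * φ σ

/-- The expectation of `O` under independent replicas with weights `softmax x`. -/
def replicaAvg {κ : Type*} [Fintype κ] [DecidableEq κ] (x : S → ℝ) (O : (κ → S) → ℝ) : ℝ :=
  ∑ s : κ → S, O s * ∏ k, softmax x (s k)

theorem softmax_nonneg (x : S → ℝ) (σ : S) : 0 ≤ softmax x σ := by
  unfold softmax; positivity

theorem sum_exp_pos [Nonempty S] (x : S → ℝ) : 0 < ∑ τ, Real.exp (x τ) :=
  Finset.sum_pos (fun _ _ => Real.exp_pos _) Finset.univ_nonempty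

theorem sum_softmax [Nonempty S] (x : S → ℝ) : ∑ σ, softmax x σ = 1 := by
  unfold softmax
  rw [← Finset.sum_div, div_self (sum_exp_pos x).ne']

theorem softmax_le_one [Nonempty S] (x : S → ℝ) (σ : S) : softmax x σ ≤ 1 := by
  rw [← sum_softmax x]
  exact Finset.single_le_sum (fun τ _ => softmax_nonneg x τ) (Finset.mem_univ σ)

theorem softmaxAvg_const [Nonempty S] (x : S → ℝ) (c : ℝ) : softmaxAvg x (fun _ => c) = c := by
  simp [softmaxAvg, ← Finset.sum_mul, sum_softmax]

theorem softmaxAvg_mono {x φ ψ : S → ℝ} (h : ∀ σ, φ σ ≤ ψ σ) :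
    softmaxAvg x φ ≤ softmaxAvg x ψ :=
  Finset.sum_le_sum fun σ _ => mul_le_mul_of_nonneg_left (h σ) (softmax_nonneg x σ)

theorem softmaxAvg_add (x φ ψ : S → ℝ) :
    softmaxAvg x (fun σ => φ σ + ψ σ) = softmaxAvg x φ + softmaxAvg x ψ := by
  simp [softmaxAvg, mul_add, Finset.sum_add_distrib]

theorem softmaxAvg_sub (x φ ψ : S → ℝ) :
    softmaxAvg x (fun σ => φ σ - ψ σ) = softmaxAvg x φ - softmaxAvg x ψ := by
  simp [softmaxAvg, mul_sub, Finset.sum_sub_distrib]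

theorem softmaxAvg_const_mul (x φ : S → ℝ) (c : ℝ) :
    softmaxAvg x (fun σ => c * φ σ) = c * softmaxAvg x φ := by
  simp only [softmaxAvg, Finset.mul_sum]
  exact Finset.sum_congr rfl fun _ _ => by ring

theorem abs_softmaxAvg_le [Nonempty S] (x : S → ℝ) {φ : S → ℝ} {C : ℝ} (h : ∀ σ, |φ σ| ≤ C) :
    |softmaxAvg x φ| ≤ C := by
  rw [abs_le]
  constructor
  · rw [← softmaxAvg_const x (-C)]
    exact softmaxAvg_mono fun σ => (abs_le.1 (h σ)).1
  · rw [← softmaxAvg_const x C]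
    exact softmaxAvg_mono fun σ => (abs_le.1 (h σ)).2

theorem continuous_softmax {Z : Type*} [TopologicalSpace Z] {X : Z → S → ℝ}
    (hX : ∀ σ, Continuous fun z => X z σ) (σ : S) : Continuous fun z => softmax (X z) σ := by
  have : Nonempty S := ⟨σ⟩
  unfold softmax
  refine ((hX σ).rexp).div (continuous_finsetSum _ fun τ _ => (hX τ).rexp) fun z => ?_
  exact (sum_exp_pos _).ne'

theorem continuous_softmaxAvg {Z : Type*} [TopologicalSpace Z] {X Φ : Z → S → ℝ}
    (hX : ∀ σ, Continuous fun z => X z σ) (hΦ : ∀ σ, Continuous fun z => Φ z σ) :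
    Continuous fun z => softmaxAvg (X z) (Φ z) :=
  continuous_finsetSum _ fun σ _ => (continuous_softmax hX σ).mul (hΦ σ)

theorem hasDerivAt_softmax {X : ℝ → S → ℝ} {y : S → ℝ} {t : ℝ}
    (hX : ∀ σ, HasDerivAt (fun t => X t σ) (y σ) t) (σ : S) :
    HasDerivAt (fun t => softmax (X t) σ)
      (softmax (X t) σ * (y σ - softmaxAvg (X t) y)) t := by
  have : Nonempty S := ⟨σ⟩
  have hZ := (sum_exp_pos (X t)).ne'
  have h1 := (hX σ).exp
  have h2 : HasDerivAt (fun t => ∑ τ, Real.exp (X t τ)) (∑ τ, Real.exp (X t τ) * y τ) t :=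
    HasDerivAt.fun_sum fun τ _ => (hX τ).exp
  refine (h1.div h2 hZ).congr_deriv ?_
  have h3 : softmaxAvg (X t) y = (∑ τ, Real.exp (X t τ) * y τ) / ∑ τ, Real.exp (X t τ) := by
    rw [softmaxAvg, Finset.sum_div]
    exact Finset.sum_congr rfl fun τ _ => by rw [softmax]; ring
  rw [h3, softmax]
  field_simp

/-- Differentiating the normalisation produces the subtracted product, so the derivative of a Gibbs
mean is a covariance. Along β it yields minus the Gibbs variance of the energy. -/
theorem hasDerivAt_softmaxAvg {X : ℝ → S → ℝ} {y φ : S → ℝ} {t : ℝ}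
    (hX : ∀ σ, HasDerivAt (fun t => X t σ) (y σ) t) :
    HasDerivAt (fun t => softmaxAvg (X t) φ)
      (softmaxAvg (X t) (fun σ => y σ * φ σ) - softmaxAvg (X t) y * softmaxAvg (X t) φ) t := by
  have : HasDerivAt (fun t => ∑ σ, softmax (X t) σ * φ σ)
      (∑ σ, softmax (X t) σ * (y σ - softmaxAvg (X t) y) * φ σ) t :=
    HasDerivAt.fun_sum fun σ _ => (hasDerivAt_softmax hX σ).mul_const (φ σ)
  refine this.congr_deriv ?_
  rw [← softmaxAvg_const_mul, ← softmaxAvg_sub]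
  exact Finset.sum_congr rfl fun σ _ => by ring

/-- Jensen's inequality for the logarithm of the partition function. -/
theorem softmaxAvg_le_log_sub_log [Nonempty S] (x y : S → ℝ) :
    softmaxAvg x y ≤ Real.log (∑ σ, Real.exp (x σ + y σ)) - Real.log (∑ σ, Real.exp (x σ)) := by
  have hZ := sum_exp_pos x
  have hZ' := sum_exp_pos fun σ => x σ + y σ
  rw [← Real.log_div hZ'.ne' hZ.ne', Real.le_log_iff_exp_le (div_pos hZ' hZ)]
  have h1 : (∑ σ, Real.exp (x σ + y σ)) / ∑ σ, Real.exp (x σ)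
      = softmaxAvg x (fun σ => Real.exp (y σ)) := by
    rw [softmaxAvg, Finset.sum_div]
    exact Finset.sum_congr rfl fun τ _ => by rw [softmax, Real.exp_add]; ring
  rw [h1]
  set m := softmaxAvg x y
  -- The exponential lies above its tangent at the mean m, and the tangent averages to exp m.
  have h2 : softmaxAvg x (fun σ => Real.exp m * (y σ - m + 1))
      ≤ softmaxAvg x (fun σ => Real.exp (y σ)) := by
    refine softmaxAvg_mono fun σ => ?_
    calc Real.exp m * (y σ - m + 1) ≤ Real.exp m * Real.exp (y σ - m) :=
          mul_le_mul_of_nonneg_left (Real.add_one_le_exp _) (Real.exp_pos _).le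
      _ = Real.exp (y σ) := by rw [← Real.exp_add]; ring_nf
  refine le_trans (le_of_eq ?_) h2
  rw [softmaxAvg_const_mul, softmaxAvg_add x (fun σ => y σ - m) (fun _ => 1), softmaxAvg_const,
    softmaxAvg_sub x y (fun _ => m), softmaxAvg_const]
  simp [m]

/-- Jensen's inequality used in both directions bounds each increment by a Gibbs average of
differences, hence by C. This is the source of the Lipschitz dependence of the pressure on the
couplings. -/
theorem abs_log_sum_exp_sub_le [Nonempty S] {x y : S → ℝ} {C : ℝ} (h : ∀ σ, |x σ - y σ| ≤ C) :
    |Real.log (∑ σ, Real.exp (x σ)) - Real.log (∑ σ, Real.exp (y σ))| ≤ C := by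
  have key : ∀ x y : S → ℝ, (∀ σ, |x σ - y σ| ≤ C) →
      Real.log (∑ σ, Real.exp (y σ)) - Real.log (∑ σ, Real.exp (x σ)) ≤ C := by
    intro x y h
    have h1 := softmaxAvg_le_log_sub_log y (fun σ => x σ - y σ)
    have h2 := (abs_le.1 (abs_softmaxAvg_le y (φ := fun σ => x σ - y σ) h)).1
    simp only [add_sub_cancel] at h1
    linarith
  rw [abs_sub_le_iff]
  exact ⟨key y x fun σ => by rw [abs_sub_comm]; exact h σ, key x y h⟩

end Softmax

/-! ### Independent replicas -/

section Replicas

variable {S : Type*} [Fintype S] {κ κ' : Type*} [Fintype κ] [DecidableEq κ] [Fintype κ']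
  [DecidableEq κ']

theorem prod_softmax_nonneg {κ : Type*} [Fintype κ] (x : S → ℝ) (s : κ → S) : 0 ≤ ∏ k, softmax x (s k) :=
  Finset.prod_nonneg fun k _ => softmax_nonneg x (s k)

theorem prod_softmax_le_one {κ : Type*} [Fintype κ] [Nonempty S] (x : S → ℝ) (s : κ → S) :
    ∏ k, softmax x (s k) ≤ 1 :=
  Finset.prod_le_one (fun k _ => softmax_nonneg x (s k)) fun k _ => softmax_le_one x (s k)

theorem sum_prod_softmax [Nonempty S] (x : S → ℝ) : ∑ s : κ → S, ∏ k, softmax x (s k) = 1 := by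
  have := Finset.prod_univ_sum (fun _ : κ => (Finset.univ : Finset S)) (fun _ σ => softmax x σ)
  rw [Fintype.piFinset_univ] at this
  rw [← this]
  simp [sum_softmax]

/-- The replicas outside the range of an injection can be summed out. -/
theorem replicaAvg_comp_injective [Nonempty S] (x : S → ℝ) {e : κ → κ'}
    (he : Function.Injective e) (O : (κ → S) → ℝ) :
    replicaAvg x (fun s : κ' → S => O (s ∘ e)) = replicaAvg x O := by
  classical
  -- Split the replicas into those in the range of e and the others; the weights of the others
  -- factor out and sum to 1.
  let E : κ ⊕ ((Set.range e)ᶜ : Set κ') ≃ κ' :=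
    (Equiv.sumCongr (Equiv.ofInjective e he) (Equiv.refl _)).trans (Equiv.Set.sumCompl (Set.range e))
  have hE : ∀ k, E.symm (e k) = Sum.inl k := fun k => by
    rw [Equiv.symm_apply_eq]; simp [E]
  unfold replicaAvg
  rw [← (Equiv.arrowCongr E (Equiv.refl S)).sum_comp,
    ← (Equiv.sumArrowEquivProdArrow κ ((Set.range e)ᶜ : Set κ') S).symm.sum_comp,
    Fintype.sum_prod_type]
  refine Finset.sum_congr rfl fun u _ => ?_
  have hprod : ∀ r : ((Set.range e)ᶜ : Set κ') → S,
      O ((Equiv.arrowCongr E (Equiv.refl S))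
        ((Equiv.sumArrowEquivProdArrow κ ((Set.range e)ᶜ : Set κ') S).symm (u, r)) ∘ e)
      * ∏ k, softmax x ((Equiv.arrowCongr E (Equiv.refl S))
        ((Equiv.sumArrowEquivProdArrow κ ((Set.range e)ᶜ : Set κ') S).symm (u, r)) k)
      = (O u * ∏ k, softmax x (u k)) * ∏ k, softmax x (r k) := by
    intro r
    have h1 : (Equiv.arrowCongr E (Equiv.refl S))
        ((Equiv.sumArrowEquivProdArrow κ ((Set.range e)ᶜ : Set κ') S).symm (u, r)) ∘ e = u := by
      ext k; simp [hE]
    rw [h1, ← E.prod_comp, Fintype.prod_sum_type, ← mul_assoc]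
    simp
  simp only [hprod]
  rw [← Finset.mul_sum, sum_prod_softmax, mul_one]

/-- `Option κ` is κ with one replica adjoined; summing over the adjoined replica first leaves its
Gibbs average. -/
theorem replicaAvg_option (x : S → ℝ) (φ : (κ → S) → S → ℝ) :
    replicaAvg x (fun s : Option κ → S => φ (s ∘ some) (s none))
      = replicaAvg x (fun u : κ → S => softmaxAvg x (φ u)) := by
  unfold replicaAvg softmaxAvg
  rw [← (Equiv.piOptionEquivProd (β := fun _ : Option κ => S)).symm.sum_comp,
    Fintype.sum_prod_type, Finset.sum_comm]
  refine Finset.sum_congr rfl fun u _ => ?_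
  rw [Finset.sum_mul]
  refine Finset.sum_congr rfl fun σ _ => ?_
  have : ((Equiv.piOptionEquivProd (β := fun _ : Option κ => S)).symm (σ, u)) ∘ some = u := by
    ext k; simp [Equiv.piOptionEquivProd]
  beta_reduce
  rw [this, Fintype.prod_option]
  simp [Equiv.piOptionEquivProd]
  ring

/-- Integrating out a replica on which the observable depends. -/
theorem replicaAvg_extra_replica [Nonempty S] (x : S → ℝ) {e : κ → κ'}
    (he : Function.Injective e) {r : κ'} (hr : ∀ k, e k ≠ r) (φ : (κ → S) → S → ℝ) :
    replicaAvg x (fun s : κ' → S => φ (s ∘ e) (s r))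
      = replicaAvg x (fun u : κ → S => softmaxAvg x (φ u)) := by
  have he' : Function.Injective (fun o : Option κ => o.elim r e) := by
    rintro (_ | a) (_ | b) h
    · rfl
    · exact absurd h.symm (hr b)
    · exact absurd h (hr a)
    · exact congrArg some (he h)
  rw [← replicaAvg_option, ← replicaAvg_comp_injective x he']
  rfl

theorem replicaAvg_eval [Nonempty S] (x : S → ℝ) (k : κ) (φ : S → ℝ) :
    replicaAvg x (fun s : κ → S => φ (s k)) = softmaxAvg x φ := by
  -- With an empty family of other replicas, the observable depends on the replica k alone.
  have h := replicaAvg_extra_replica x (κ := Empty) (e := fun z : Empty => (z.elim : κ))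
    (fun z => z.elim) (r := k) (fun z => z.elim) (fun _ => φ)
  rw [h]
  simp [replicaAvg]

theorem replicaAvg_mono {x : S → ℝ} {O O' : (κ → S) → ℝ} (h : ∀ s, O s ≤ O' s) :
    replicaAvg x O ≤ replicaAvg x O' :=
  Finset.sum_le_sum fun s _ => mul_le_mul_of_nonneg_right (h s) (prod_softmax_nonneg x s)

theorem replicaAvg_add (x : S → ℝ) (O O' : (κ → S) → ℝ) :
    replicaAvg x (fun s => O s + O' s) = replicaAvg x O + replicaAvg x O' := by
  simp [replicaAvg, add_mul, Finset.sum_add_distrib]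

theorem replicaAvg_sub (x : S → ℝ) (O O' : (κ → S) → ℝ) :
    replicaAvg x (fun s => O s - O' s) = replicaAvg x O - replicaAvg x O' := by
  simp [replicaAvg, sub_mul, Finset.sum_sub_distrib]

theorem replicaAvg_const_mul (x : S → ℝ) (c : ℝ) (O : (κ → S) → ℝ) :
    replicaAvg x (fun s => c * O s) = c * replicaAvg x O := by
  simp only [replicaAvg, Finset.mul_sum, mul_assoc]

theorem replicaAvg_sum {α : Type*} (A : Finset α) (x : S → ℝ) (O : α → (κ → S) → ℝ) :
    replicaAvg x (fun s => ∑ j ∈ A, O j s) = ∑ j ∈ A, replicaAvg x (O j) := by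
  simp only [replicaAvg, Finset.sum_mul]
  exact Finset.sum_comm

theorem replicaAvg_const [Nonempty S] (x : S → ℝ) (c : ℝ) :
    replicaAvg x (fun _ : κ → S => c) = c := by
  simp [replicaAvg, ← Finset.mul_sum, sum_prod_softmax]

theorem abs_replicaAvg_le (x : S → ℝ) (O : (κ → S) → ℝ) :
    |replicaAvg x O| ≤ replicaAvg x (fun s => |O s|) := by
  refine (Finset.abs_sum_le_sum_abs _ _).trans (le_of_eq (Finset.sum_congr rfl fun s _ => ?_))
  rw [abs_mul, abs_of_nonneg (prod_softmax_nonneg x s)]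

theorem abs_replicaAvg_le_of_le [Nonempty S] (x : S → ℝ) {O : (κ → S) → ℝ} {C : ℝ}
    (h : ∀ s, |O s| ≤ C) : |replicaAvg x O| ≤ C :=
  (abs_replicaAvg_le x O).trans ((replicaAvg_mono h).trans (replicaAvg_const x C).le)

theorem continuous_prod_softmax {κ : Type*} [Fintype κ] {Z : Type*} [TopologicalSpace Z] {X : Z → S → ℝ}
    (hX : ∀ σ, Continuous fun z => X z σ) (s : κ → S) :
    Continuous fun z => ∏ k, softmax (X z) (s k) :=
  continuous_finsetProd _ fun k _ => continuous_softmax hX (s k)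

theorem continuous_replicaAvg {Z : Type*} [TopologicalSpace Z] {X : Z → S → ℝ}
    {O : Z → (κ → S) → ℝ} (hX : ∀ σ, Continuous fun z => X z σ)
    (hO : ∀ s, Continuous fun z => O z s) :
    Continuous fun z => replicaAvg (X z) (O z) :=
  continuous_finsetSum _ fun s _ => (hO s).mul (continuous_prod_softmax hX s)

/-- Logarithmic derivatives of the factors add. The centring term carries the number of replicas,
which later becomes the coefficient of the overlap with an unused replica. -/
theorem hasDerivAt_prod_softmax {X : ℝ → S → ℝ} {y : S → ℝ} {t : ℝ}
    (hX : ∀ σ, HasDerivAt (fun t => X t σ) (y σ) t) (s : κ → S) :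
    HasDerivAt (fun t => ∏ k, softmax (X t) (s k))
      ((∑ k, y (s k) - Fintype.card κ * softmaxAvg (X t) y) * ∏ k, softmax (X t) (s k)) t := by
  have := HasDerivAt.fun_finsetProd (u := Finset.univ) (f := fun k t => softmax (X t) (s k))
    (fun k _ => hasDerivAt_softmax hX (s k))
  refine this.congr_deriv ?_
  have h : ∀ k, (∏ j ∈ Finset.univ.erase k, softmax (X t) (s j))
      • (softmax (X t) (s k) * (y (s k) - softmaxAvg (X t) y))
      = (y (s k) - softmaxAvg (X t) y) * ∏ k, softmax (X t) (s k) := fun k => by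
    rw [smul_eq_mul, ← Finset.prod_erase_mul _ _ (Finset.mem_univ k)]; ring
  simp only [h]
  rw [← Finset.sum_mul, Finset.sum_sub_distrib]
  simp

end Replicas

/-! ### Energies affine in independent Gaussian couplings -/

section LinearModel

variable {S ι : Type*} [Fintype ι]

/-- An energy that is affine in the couplings `x`. -/
def energy (a : S → ι → ℝ) (b : S → ℝ) (x : ι → ℝ) (σ : S) : ℝ := b σ - ∑ i, x i * a σ i

/-- The covariance of the energies for independent couplings with variances `v`. -/
def energyCov (a : S → ι → ℝ) (v : ι → ℝ≥0) (σ τ : S) : ℝ := ∑ i, v i * a σ i * a τ i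

/-- The logarithm of the Boltzmann factor. -/
def logBoltzmann (a : S → ι → ℝ) (b : S → ℝ) (β : ℝ) (x : ι → ℝ) (σ : S) : ℝ :=
  -β * energy a b x σ

variable {a : S → ι → ℝ} {b : S → ℝ}

theorem continuous_energy (σ : S) : Continuous fun x => energy a b x σ := by
  unfold energy; fun_prop

theorem continuous_logBoltzmann (β : ℝ) (σ : S) : Continuous fun x => logBoltzmann a b β x σ :=
  continuous_const.mul (continuous_energy σ)

theorem continuous_logBoltzmann_uncurry (σ : S) :
    Continuous fun p : ℝ × (ι → ℝ) => logBoltzmann a b p.1 p.2 σ :=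
  continuous_fst.neg.mul ((continuous_energy σ).comp continuous_snd)

theorem abs_energy_sub_le (ha : ∀ σ i, |a σ i| ≤ 1) (x y : ι → ℝ) (σ : S) :
    |energy a b x σ - energy a b y σ| ≤ ∑ i, |x i - y i| := by
  have : energy a b x σ - energy a b y σ = -∑ i, (x i - y i) * a σ i := by
    simp only [energy, sub_mul, Finset.sum_sub_distrib]; ring
  rw [this, abs_neg]
  refine (Finset.abs_sum_le_sum_abs _ _).trans (Finset.sum_le_sum fun i _ => ?_)
  rw [abs_mul]
  exact mul_le_of_le_one_right (abs_nonneg _) (ha σ i)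

theorem abs_energy_le (ha : ∀ σ i, |a σ i| ≤ 1) {A : ℝ} (hb : ∀ σ, |b σ| ≤ A) (x : ι → ℝ)
    (σ : S) : |energy a b x σ| ≤ A + ∑ i, |x i| := by
  have h := abs_energy_sub_le (b := b) ha x 0 σ
  have h0 : energy a b 0 σ = b σ := by simp [energy]
  simp only [h0, Pi.zero_apply, sub_zero] at h
  have h1 : |energy a b x σ| ≤ |b σ| + |energy a b x σ - b σ| := by
    have := abs_add_le (b σ) (energy a b x σ - b σ); simpa using this
  linarith [hb σ]

theorem abs_energyCov_le (ha : ∀ σ i, |a σ i| ≤ 1) (v : ι → ℝ≥0) (σ τ : S) :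
    |energyCov a v σ τ| ≤ ∑ i, (v i : ℝ) := by
  refine (Finset.abs_sum_le_sum_abs _ _).trans (Finset.sum_le_sum fun i _ => ?_)
  rw [abs_mul, abs_mul, NNReal.abs_eq, mul_assoc]
  exact mul_le_of_le_one_right (v i).2
    (mul_le_one₀ (ha σ i) (abs_nonneg _) (ha τ i))

theorem energyCov_comm (v : ι → ℝ≥0) (σ τ : S) : energyCov a v σ τ = energyCov a v τ σ :=
  Finset.sum_congr rfl fun i _ => by ring

theorem hasDerivAt_logBoltzmann_update [DecidableEq ι] (β : ℝ) (x : ι → ℝ) (i : ι) (t : ℝ)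
    (σ : S) :
    HasDerivAt (fun t => logBoltzmann a b β (Function.update x i t) σ) (β * a σ i) t := by
  have h : ∀ j, HasDerivAt (fun t => Function.update x i t j * a σ j)
      ((if j = i then 1 else 0) * a σ j) t := by
    intro j
    by_cases hj : j = i
    · subst hj
      simpa using (hasDerivAt_id t).mul_const (a σ j)
    · simpa [hj] using hasDerivAt_const t (x j * a σ j)
  have h1 := ((HasDerivAt.fun_sum fun j (_ : j ∈ Finset.univ) => h j).const_sub (b σ)).const_mul
    (-β)
  refine h1.congr_deriv ?_
  simp

theorem hasDerivAt_logBoltzmann_beta (x : ι → ℝ) (β : ℝ) (σ : S) :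
    HasDerivAt (fun β => logBoltzmann a b β x σ) (-energy a b x σ) β := by
  exact ((hasDerivAt_id β).neg.mul_const (energy a b x σ)).congr_deriv (by simp)

variable [Fintype S] {κ κ' : Type*} [Fintype κ] [DecidableEq κ] [Fintype κ'] [DecidableEq κ']

theorem continuous_softmaxAvg_logBoltzmann (β : ℝ) (φ : S → ℝ) :
    Continuous fun x => softmaxAvg (logBoltzmann a b β x) φ :=
  continuous_softmaxAvg (continuous_logBoltzmann β) fun _ => continuous_const

/-- The quenched expectation of an observable of independent replicas. -/
def quenchedAvg (a : S → ι → ℝ) (b : S → ℝ) (v : ι → ℝ≥0) (β : ℝ) (O : (κ → S) → ℝ) : ℝ :=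
  ∫ x, replicaAvg (logBoltzmann a b β x) O ∂gaussianPi v

theorem integrable_replicaAvg [Nonempty S] (v : ι → ℝ≥0) (β : ℝ) (O : (κ → S) → ℝ) :
    Integrable (fun x => replicaAvg (logBoltzmann a b β x) O) (gaussianPi v) := by
  refine Integrable.of_bound (C := ∑ s, |O s|) (Continuous.aestronglyMeasurable ?_)
    (ae_of_all _ fun x => abs_replicaAvg_le_of_le _ fun s => ?_)
  · exact continuous_replicaAvg (continuous_logBoltzmann β) fun s => continuous_const
  · exact Finset.single_le_sum (f := fun s => |O s|) (fun _ _ => abs_nonneg _) (Finset.mem_univ s)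

theorem integrable_prod_softmax {κ : Type*} [Fintype κ] [Nonempty S] (v : ι → ℝ≥0) (β : ℝ) (s : κ → S) :
    Integrable (fun x => ∏ k, softmax (logBoltzmann a b β x) (s k)) (gaussianPi v) := by
  refine Integrable.of_bound (C := 1) (Continuous.aestronglyMeasurable ?_)
    (ae_of_all _ fun x => ?_)
  · exact continuous_prod_softmax (continuous_logBoltzmann β) s
  · rw [Real.norm_eq_abs, abs_of_nonneg (prod_softmax_nonneg _ _)]
    exact prod_softmax_le_one _ _

/-- Gaussian integration by parts for the Gibbs weight of a family of replicas. -/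
theorem integral_eval_mul_prod_softmax {κ : Type*} [Fintype κ] [Nonempty S]
    (ha : ∀ σ i, |a σ i| ≤ 1) (v : ι → ℝ≥0) (β : ℝ) (s : κ → S) (i : ι) :
    ∫ x, x i * ∏ k, softmax (logBoltzmann a b β x) (s k) ∂gaussianPi v
      = v i * ∫ x, β * (∑ k, a (s k) i
          - Fintype.card κ * softmaxAvg (logBoltzmann a b β x) (fun σ => a σ i))
          * ∏ k, softmax (logBoltzmann a b β x) (s k) ∂gaussianPi v := by
  classical
  have hC : 0 ≤ |β| * (Fintype.card κ + Fintype.card κ * 1) := by positivity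
  refine integral_eval_mul_gaussianPi v i
    (F := fun x => ∏ k, softmax (logBoltzmann a b β x) (s k))
    (F' := fun x => β * (∑ k, a (s k) i
      - Fintype.card κ * softmaxAvg (logBoltzmann a b β x) (fun σ => a σ i))
      * ∏ k, softmax (logBoltzmann a b β x) (s k))
    -- A single constant has to bound both the weight, which is at most 1, and its derivative.
    (C := 1 + |β| * (Fintype.card κ + Fintype.card κ * 1))
    (continuous_prod_softmax (continuous_logBoltzmann β) s) ?_ ?_ ?_ ?_
  · exact (continuous_const.mul (continuous_const.sub (continuous_const.mul
      (continuous_softmaxAvg_logBoltzmann (a := a) (b := b) β _)))).mul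
      (continuous_prod_softmax (continuous_logBoltzmann β) s)
  · intro x t
    refine (hasDerivAt_prod_softmax (y := fun σ => β * a σ i) (fun σ => hasDerivAt_logBoltzmann_update β x i t σ)
      s).congr_deriv ?_
    rw [softmaxAvg_const_mul, ← Finset.mul_sum]
    ring
  · intro x
    rw [abs_of_nonneg (prod_softmax_nonneg _ _)]
    linarith [prod_softmax_le_one (logBoltzmann a b β x) s]
  · intro x
    rw [abs_mul, abs_mul, abs_of_nonneg (prod_softmax_nonneg _ _)]
    have h1 : |∑ k, a (s k) i| ≤ Fintype.card κ := by
      refine (Finset.abs_sum_le_sum_abs _ _).trans ?_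
      refine (Finset.sum_le_sum fun k _ => ha (s k) i).trans ?_
      simp
    have h2 := abs_softmaxAvg_le (logBoltzmann a b β x) (φ := fun σ => a σ i) fun σ => ha σ i
    have h3 : |(Fintype.card κ : ℝ) * softmaxAvg (logBoltzmann a b β x) (fun σ => a σ i)|
        ≤ Fintype.card κ * 1 := by
      rw [abs_mul, abs_of_nonneg (Nat.cast_nonneg _)]
      exact mul_le_mul_of_nonneg_left h2 (Nat.cast_nonneg _)
    have h4 := (abs_sub _ _).trans (add_le_add h1 h3)
    have h5 := mul_le_mul (mul_le_mul_of_nonneg_left h4 (abs_nonneg β))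
      (prod_softmax_le_one (logBoltzmann a b β x) s) (prod_softmax_nonneg _ _) hC
    linarith

/-- The energy is expanded in the couplings, each coupling is integrated by parts, and the factors v
i reassemble the covariances. The centring term is still a Gibbs average; it becomes an overlap only
when a further replica is introduced. -/
theorem integral_energy_mul_prod_softmax {κ : Type*} [Fintype κ] [Nonempty S]
    (ha : ∀ σ i, |a σ i| ≤ 1) (v : ι → ℝ≥0) (β : ℝ) (s : κ → S) (σ : S) :
    ∫ x, energy a b x σ * ∏ k, softmax (logBoltzmann a b β x) (s k) ∂gaussianPi v
      = ∫ x, (b σ - β * (∑ k, energyCov a v σ (s k)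
          - Fintype.card κ * softmaxAvg (logBoltzmann a b β x) (energyCov a v σ)))
          * ∏ k, softmax (logBoltzmann a b β x) (s k) ∂gaussianPi v := by
  set w : (ι → ℝ) → ℝ := fun x => ∏ k, softmax (logBoltzmann a b β x) (s k) with hw
  have hwi : Integrable w (gaussianPi v) := integrable_prod_softmax v β s
  have hxw : ∀ i, Integrable (fun x => x i * w x) (gaussianPi v) := fun i =>
    ((memLp_eval_gaussianPi v i).integrable one_le_two).mul_bdd (c := 1)
      (continuous_prod_softmax (continuous_logBoltzmann β) s).aestronglyMeasurable
      (ae_of_all _ fun x => by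
        rw [Real.norm_eq_abs, abs_of_nonneg (prod_softmax_nonneg _ _)]
        exact prod_softmax_le_one _ _)
  have hai : ∀ i, Integrable (fun x => β * (∑ k, a (s k) i
      - Fintype.card κ * softmaxAvg (logBoltzmann a b β x) (fun σ => a σ i)) * w x)
      (gaussianPi v) := by
    intro i
    refine hwi.bdd_mul (c := |β| * (|∑ k, a (s k) i| + Fintype.card κ * 1))
      (Continuous.aestronglyMeasurable ?_) (ae_of_all _ fun x => ?_)
    · exact continuous_const.mul (continuous_const.sub (continuous_const.mul
        (continuous_softmaxAvg_logBoltzmann (a := a) (b := b) β _)))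
    · rw [Real.norm_eq_abs, abs_mul]
      refine mul_le_mul_of_nonneg_left ((abs_sub _ _).trans (add_le_add le_rfl ?_)) (abs_nonneg _)
      rw [abs_mul, abs_of_nonneg (Nat.cast_nonneg _)]
      exact mul_le_mul_of_nonneg_left (abs_softmaxAvg_le _ fun σ => ha σ i) (Nat.cast_nonneg _)
  have hL : ∀ x, energy a b x σ * w x = b σ * w x - ∑ i, a σ i * (x i * w x) := by
    intro x
    simp only [energy, sub_mul, Finset.sum_mul]
    congr 1
    exact Finset.sum_congr rfl fun i _ => by ring
  have hcov : ∀ x, softmaxAvg (logBoltzmann a b β x) (energyCov a v σ)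
      = ∑ i, v i * a σ i * softmaxAvg (logBoltzmann a b β x) (fun τ => a τ i) := by
    intro x
    simp only [softmaxAvg, energyCov, Finset.mul_sum]
    rw [Finset.sum_comm]
    exact Finset.sum_congr rfl fun i _ => Finset.sum_congr rfl fun τ _ => by ring
  have hR : ∀ x, (b σ - β * (∑ k, energyCov a v σ (s k)
      - Fintype.card κ * softmaxAvg (logBoltzmann a b β x) (energyCov a v σ))) * w x
      = b σ * w x - ∑ i, a σ i * (v i * (β * (∑ k, a (s k) i
          - Fintype.card κ * softmaxAvg (logBoltzmann a b β x) (fun σ => a σ i)) * w x)) := by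
    intro x
    rw [hcov x]
    have h1 : ∑ k, energyCov a v σ (s k) = ∑ i, v i * a σ i * ∑ k, a (s k) i := by
      simp only [energyCov, Finset.mul_sum]
      rw [Finset.sum_comm]
    have h2 : ∑ i, a σ i * (v i * (β * (∑ k, a (s k) i
          - Fintype.card κ * softmaxAvg (logBoltzmann a b β x) (fun σ => a σ i)) * w x))
        = β * (∑ i, v i * a σ i * ∑ k, a (s k) i - Fintype.card κ
          * ∑ i, v i * a σ i * softmaxAvg (logBoltzmann a b β x) (fun τ => a τ i)) * w x := by
      rw [Finset.mul_sum, ← Finset.sum_sub_distrib, Finset.mul_sum, Finset.sum_mul]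
      exact Finset.sum_congr rfl fun i _ => by ring
    rw [h1, h2]
    ring
  refine (integral_congr_ae (ae_of_all _ hL)).trans
    (Eq.trans ?_ (integral_congr_ae (ae_of_all _ hR)).symm)
  rw [integral_sub (hwi.const_mul _) (integrable_finsetSum _ fun i _ => (hxw i).const_mul _),
    integral_sub (hwi.const_mul _)
      (integrable_finsetSum _ fun i _ => ((hai i).const_mul _).const_mul _),
    integral_finsetSum _ (fun i _ => (hxw i).const_mul _),
    integral_finsetSum _ (fun i _ => ((hai i).const_mul _).const_mul _)]
  congr 1
  refine Finset.sum_congr rfl fun i _ => ?_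
  rw [integral_const_mul, integral_const_mul, integral_const_mul]
  congr 1
  exact integral_eval_mul_prod_softmax ha v β s i

theorem integrable_energy_mul_prod_softmax {κ : Type*} [Fintype κ] [Nonempty S]
    (ha : ∀ σ i, |a σ i| ≤ 1) (v : ι → ℝ≥0) (β : ℝ) (s : κ → S) (σ : S) :
    Integrable (fun x => energy a b x σ * ∏ k, softmax (logBoltzmann a b β x) (s k))
      (gaussianPi v) := by
  refine integrable_of_continuous_of_le_mul_const_add_sum_abs v (A := |b σ|) (K := 1)
    ((continuous_energy σ).mul (continuous_prod_softmax (continuous_logBoltzmann β) s))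
    fun x => ?_
  rw [abs_mul, abs_of_nonneg (prod_softmax_nonneg _ _), one_mul]
  have h := abs_energy_sub_le (b := b) ha x 0 σ
  have h0 : energy a b 0 σ = b σ := by simp [energy]
  simp only [h0, Pi.zero_apply, sub_zero] at h
  have h1 : |energy a b x σ| ≤ |b σ| + |energy a b x σ - b σ| := by
    have := abs_add_le (b σ) (energy a b x σ - b σ); simpa using this
  exact (mul_le_of_le_one_right (abs_nonneg _) (prod_softmax_le_one _ _)).trans (by linarith)

/-- Gaussian integration by parts for the quenched state: the energy of a replica on which the
observable depends. -/
theorem integral_replicaAvg_energy [Nonempty S] (ha : ∀ σ i, |a σ i| ≤ 1) (v : ι → ℝ≥0)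
    (β : ℝ) (l : κ) (O : (κ → S) → ℝ) :
    ∫ x, replicaAvg (logBoltzmann a b β x) (fun s => energy a b x (s l) * O s) ∂gaussianPi v
      = ∫ x, replicaAvg (logBoltzmann a b β x) (fun s => (b (s l) - β * (∑ k,
          energyCov a v (s l) (s k) - Fintype.card κ
            * softmaxAvg (logBoltzmann a b β x) (energyCov a v (s l)))) * O s) ∂gaussianPi v := by
  unfold replicaAvg
  have hint : ∀ s : κ → S, Integrable (fun x => (b (s l) - β * (∑ k, energyCov a v (s l) (s k)
      - Fintype.card κ * softmaxAvg (logBoltzmann a b β x) (energyCov a v (s l))))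
      * ∏ k, softmax (logBoltzmann a b β x) (s k)) (gaussianPi v) := by
    intro s
    refine (integrable_prod_softmax v β s).bdd_mul (c := |b (s l)| + |β| * (|∑ k,
      energyCov a v (s l) (s k)| + Fintype.card κ * ∑ i, (v i : ℝ)))
      (Continuous.aestronglyMeasurable ?_) (ae_of_all _ fun x => ?_)
    · exact continuous_const.sub (continuous_const.mul (continuous_const.sub (continuous_const.mul
        (continuous_softmaxAvg_logBoltzmann (a := a) (b := b) β _))))
    · rw [Real.norm_eq_abs]
      refine (abs_sub _ _).trans (add_le_add le_rfl ?_)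
      rw [abs_mul]
      refine mul_le_mul_of_nonneg_left ((abs_sub _ _).trans (add_le_add le_rfl ?_)) (abs_nonneg _)
      rw [abs_mul, abs_of_nonneg (Nat.cast_nonneg _)]
      exact mul_le_mul_of_nonneg_left (abs_softmaxAvg_le _ fun τ => abs_energyCov_le ha v (s l) τ)
        (Nat.cast_nonneg _)
  have h1 : ∀ (x : ι → ℝ) (s : κ → S), energy a b x (s l) * O s
      * ∏ k, softmax (logBoltzmann a b β x) (s k)
      = O s * (energy a b x (s l) * ∏ k, softmax (logBoltzmann a b β x) (s k)) :=
    fun x s => by ring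
  have h2 : ∀ (x : ι → ℝ) (s : κ → S), (b (s l) - β * (∑ k, energyCov a v (s l) (s k)
      - Fintype.card κ * softmaxAvg (logBoltzmann a b β x) (energyCov a v (s l)))) * O s
      * ∏ k, softmax (logBoltzmann a b β x) (s k)
      = O s * ((b (s l) - β * (∑ k, energyCov a v (s l) (s k)
      - Fintype.card κ * softmaxAvg (logBoltzmann a b β x) (energyCov a v (s l))))
      * ∏ k, softmax (logBoltzmann a b β x) (s k)) :=
    fun x s => by ring
  simp only [h1, h2]
  rw [integral_finsetSum _ (fun s _ => (integrable_energy_mul_prod_softmax ha v β s _).const_mul _),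
    integral_finsetSum _ (fun s _ => (hint s).const_mul _)]
  refine Finset.sum_congr rfl fun s _ => ?_
  rw [integral_const_mul, integral_const_mul, integral_energy_mul_prod_softmax ha v β s (s l)]

/-- Gaussian integration by parts for the quenched state, with the replicas embedded into a larger
family that has an additional replica `r`. -/
theorem integral_replicaAvg_energy_embedding [Nonempty S] (ha : ∀ σ i, |a σ i| ≤ 1)
    (v : ι → ℝ≥0) (β : ℝ) {e : κ → κ'} (he : Function.Injective e) {r : κ'} (hr : ∀ k, e k ≠ r)
    (l : κ) (O : (κ → S) → ℝ) :
    ∫ x, replicaAvg (logBoltzmann a b β x)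
        (fun s : κ' → S => energy a b x (s (e l)) * O (s ∘ e)) ∂gaussianPi v
      = quenchedAvg a b v β (fun s : κ' → S => b (s (e l)) * O (s ∘ e))
        - β * (∑ k, quenchedAvg a b v β
            (fun s : κ' → S => energyCov a v (s (e l)) (s (e k)) * O (s ∘ e))
          - Fintype.card κ * quenchedAvg a b v β
            (fun s : κ' → S => energyCov a v (s (e l)) (s r) * O (s ∘ e))) := by
  have h0 : ∀ x, replicaAvg (logBoltzmann a b β x)
      (fun s : κ' → S => energy a b x (s (e l)) * O (s ∘ e))
      = replicaAvg (logBoltzmann a b β x) (fun s => energy a b x (s l) * O s) := fun x =>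
    replicaAvg_comp_injective _ he (fun s => energy a b x (s l) * O s)
  have hx : ∀ x, replicaAvg (logBoltzmann a b β x) (fun s => (b (s l) - β * (∑ k,
          energyCov a v (s l) (s k) - Fintype.card κ
            * softmaxAvg (logBoltzmann a b β x) (energyCov a v (s l)))) * O s)
      = replicaAvg (logBoltzmann a b β x) (fun s : κ' → S => b (s (e l)) * O (s ∘ e))
        - β * (∑ k, replicaAvg (logBoltzmann a b β x)
            (fun s : κ' → S => energyCov a v (s (e l)) (s (e k)) * O (s ∘ e))
          - Fintype.card κ * replicaAvg (logBoltzmann a b β x)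
            (fun s : κ' → S => energyCov a v (s (e l)) (s r) * O (s ∘ e))) := by
    intro x
    have h1 := replicaAvg_comp_injective (logBoltzmann a b β x) he (fun s => b (s l) * O s)
    have h2 := fun k => replicaAvg_comp_injective (logBoltzmann a b β x) he
      (fun s => energyCov a v (s l) (s k) * O s)
    -- The Gibbs average of the covariance is realised as a covariance with the replica r, on which
    -- the observable does not depend.
    have h3 := replicaAvg_extra_replica (logBoltzmann a b β x) he hr
      (fun s τ => energyCov a v (s l) τ * O s)
    simp only [Function.comp_apply] at h1 h2 h3
    rw [h1, h3]
    simp only [h2]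
    have h4 : ∀ s : κ → S, softmaxAvg (logBoltzmann a b β x) (fun τ => energyCov a v (s l) τ * O s)
        = softmaxAvg (logBoltzmann a b β x) (energyCov a v (s l)) * O s := by
      intro s
      simp only [softmaxAvg, Finset.sum_mul, mul_assoc]
    simp only [h4]
    rw [← replicaAvg_sum, ← replicaAvg_const_mul, ← replicaAvg_sub, ← replicaAvg_const_mul,
      ← replicaAvg_sub]
    congr 1
    ext s
    rw [← Finset.sum_mul]
    ring
  simp only [h0]
  rw [integral_replicaAvg_energy ha v β l O]
  simp only [hx]
  have i1 := integrable_replicaAvg (a := a) (b := b) v β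
    (fun s : κ' → S => b (s (e l)) * O (s ∘ e))
  have i2 := fun k => integrable_replicaAvg (a := a) (b := b) v β
    (fun s : κ' → S => energyCov a v (s (e l)) (s (e k)) * O (s ∘ e))
  have i3 := integrable_replicaAvg (a := a) (b := b) v β
    (fun s : κ' → S => energyCov a v (s (e l)) (s r) * O (s ∘ e))
  have i4 := integrable_finsetSum (μ := gaussianPi v) Finset.univ fun k _ => i2 k
  have i5 : Integrable (fun x => β * (∑ k, replicaAvg (logBoltzmann a b β x)
            (fun s : κ' → S => energyCov a v (s (e l)) (s (e k)) * O (s ∘ e))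
          - Fintype.card κ * replicaAvg (logBoltzmann a b β x)
            (fun s : κ' → S => energyCov a v (s (e l)) (s r) * O (s ∘ e)))) (gaussianPi v) :=
    (i4.sub (i3.const_mul _)).const_mul _
  rw [integral_sub i1 i5, integral_const_mul, integral_sub i4 (i3.const_mul _), integral_const_mul,
    integral_finsetSum _ (fun k _ => i2 k)]
  rfl

end LinearModel

/-- The arithmetic-geometric mean inequality with a free weight. It stands in for Cauchy–Schwarz in
passing from second to first moments; the weight is later the inverse square root of the volume. -/
theorem abs_le_mul_sq_add_inv {t : ℝ} (ht : 0 < t) (u : ℝ) : |u| ≤ (t * u ^ 2 + t⁻¹) / 2 := by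
  have h : 0 ≤ t⁻¹ * (t * |u| - 1) ^ 2 := by positivity
  have h1 : t⁻¹ * (t * |u| - 1) ^ 2 = t * u ^ 2 - 2 * |u| + t⁻¹ := by
    rw [← sq_abs u]; field_simp; ring
  linarith

/-! ### Thermal and disorder fluctuations of the energy -/

section Fluctuations

variable {S ι : Type*} [Fintype ι] [Fintype S]

/-- The Gibbs expectation of the energy. -/
def gibbsEnergy (a : S → ι → ℝ) (b : S → ℝ) (β : ℝ) (x : ι → ℝ) : ℝ :=
  softmaxAvg (logBoltzmann a b β x) (energy a b x)

/-- The Gibbs variance of the energy. -/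
def gibbsVar (a : S → ι → ℝ) (b : S → ℝ) (β : ℝ) (x : ι → ℝ) : ℝ :=
  softmaxAvg (logBoltzmann a b β x) (fun σ => (energy a b x σ - gibbsEnergy a b β x) ^ 2)

/-- The Gibbs expectation of the absolute deviation of the energy. -/
def gibbsAbsDev (a : S → ι → ℝ) (b : S → ℝ) (β : ℝ) (x : ι → ℝ) : ℝ :=
  softmaxAvg (logBoltzmann a b β x) (fun σ => |energy a b x σ - gibbsEnergy a b β x|)

/-- The quenched energy. -/
def quenchedEnergy (a : S → ι → ℝ) (b : S → ℝ) (v : ι → ℝ≥0) (β : ℝ) : ℝ :=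
  ∫ x, gibbsEnergy a b β x ∂gaussianPi v

/-- The logarithm of the partition function. -/
def logPartition (a : S → ι → ℝ) (b : S → ℝ) (β : ℝ) (x : ι → ℝ) : ℝ :=
  Real.log (∑ σ, Real.exp (logBoltzmann a b β x σ))

/-- The quenched pressure. -/
def quenchedPressure (a : S → ι → ℝ) (b : S → ℝ) (v : ι → ℝ≥0) (β : ℝ) : ℝ :=
  ∫ x, logPartition a b β x ∂gaussianPi v

variable {a : S → ι → ℝ} {b : S → ℝ}

theorem continuous_gibbsEnergy :
    Continuous fun p : ℝ × (ι → ℝ) => gibbsEnergy a b p.1 p.2 :=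
  continuous_softmaxAvg continuous_logBoltzmann_uncurry fun σ =>
    (continuous_energy σ).comp continuous_snd

theorem continuous_gibbsVar : Continuous fun p : ℝ × (ι → ℝ) => gibbsVar a b p.1 p.2 :=
  continuous_softmaxAvg continuous_logBoltzmann_uncurry fun σ =>
    (((continuous_energy σ).comp continuous_snd).sub continuous_gibbsEnergy).pow 2

theorem continuous_gibbsAbsDev : Continuous fun p : ℝ × (ι → ℝ) => gibbsAbsDev a b p.1 p.2 :=
  continuous_softmaxAvg continuous_logBoltzmann_uncurry fun σ =>
    (((continuous_energy σ).comp continuous_snd).sub continuous_gibbsEnergy).abs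

theorem continuous_integral_of_continuous_of_le {v : ι → ℝ≥0} {F : ℝ → (ι → ℝ) → ℝ}
    {g : (ι → ℝ) → ℝ} (hF : Continuous fun p : ℝ × (ι → ℝ) => F p.1 p.2)
    (hg : Integrable g (gaussianPi v)) (hle : ∀ β x, |F β x| ≤ g x) :
    Continuous fun β => ∫ x, F β x ∂gaussianPi v := by
  refine continuous_of_dominated (bound := g) (fun β => Continuous.aestronglyMeasurable ?_)
    (fun β => ae_of_all _ (hle β)) hg (ae_of_all _ fun x => ?_)
  · exact hF.comp (Continuous.prodMk_right β)
  · exact hF.comp (Continuous.prodMk_left x)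

theorem intervalIntegral_integral_comm {v : ι → ℝ≥0} {F : ℝ → (ι → ℝ) → ℝ}
    {g : (ι → ℝ) → ℝ} (hF : Continuous fun p : ℝ × (ι → ℝ) => F p.1 p.2)
    (hg : Integrable g (gaussianPi v)) (hle : ∀ β x, |F β x| ≤ g x) (β₁ β₂ : ℝ) :
    ∫ β in β₁..β₂, ∫ x, F β x ∂gaussianPi v = ∫ x, (∫ β in β₁..β₂, F β x) ∂gaussianPi v := by
  have : IsFiniteMeasure (volume.restrict (Set.uIoc β₁ β₂)) := by
    rw [Set.uIoc]; infer_instance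
  have h : Integrable (fun p : ℝ × (ι → ℝ) => F p.1 p.2)
      ((volume.restrict (Set.uIoc β₁ β₂)).prod (gaussianPi v)) :=
    (hg.comp_snd _).mono' hF.aestronglyMeasurable (ae_of_all _ fun p => hle p.1 p.2)
  exact intervalIntegral_integral_swap h

variable {A : ℝ}

theorem abs_gibbsEnergy_le [Nonempty S] (ha : ∀ σ i, |a σ i| ≤ 1) (hb : ∀ σ, |b σ| ≤ A) (β : ℝ)
    (x : ι → ℝ) : |gibbsEnergy a b β x| ≤ A + ∑ i, |x i| :=
  abs_softmaxAvg_le _ fun σ => abs_energy_le ha hb x σ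

theorem abs_energy_sub_gibbsEnergy_le [Nonempty S] (ha : ∀ σ i, |a σ i| ≤ 1)
    (hb : ∀ σ, |b σ| ≤ A) (β : ℝ) (x : ι → ℝ) (σ : S) :
    |energy a b x σ - gibbsEnergy a b β x| ≤ 2 * (A + ∑ i, |x i|) := by
  refine (abs_sub _ _).trans ?_
  linarith [abs_energy_le ha hb x σ, abs_gibbsEnergy_le ha hb β x]

theorem abs_gibbsAbsDev_le [Nonempty S] (ha : ∀ σ i, |a σ i| ≤ 1) (hb : ∀ σ, |b σ| ≤ A) (β : ℝ)
    (x : ι → ℝ) : |gibbsAbsDev a b β x| ≤ 2 * (A + ∑ i, |x i|) :=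
  abs_softmaxAvg_le _ fun σ => by
    rw [abs_abs]; exact abs_energy_sub_gibbsEnergy_le ha hb β x σ

theorem abs_gibbsVar_le [Nonempty S] (ha : ∀ σ i, |a σ i| ≤ 1) (hb : ∀ σ, |b σ| ≤ A) (β : ℝ)
    (x : ι → ℝ) : |gibbsVar a b β x| ≤ 4 * (A + ∑ i, |x i|) ^ 2 :=
  abs_softmaxAvg_le _ fun σ => by
    rw [abs_pow]
    refine (pow_le_pow_left₀ (abs_nonneg _) (abs_energy_sub_gibbsEnergy_le ha hb β x σ) 2).trans
      (le_of_eq ?_)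
    ring

theorem integrable_const_add_sum_abs (v : ι → ℝ≥0) (A : ℝ) :
    Integrable (fun x : ι → ℝ => A + ∑ i, |x i|) (gaussianPi v) :=
  (memLp_const_add_sum_abs_gaussianPi v A).integrable one_le_two

theorem integrable_gibbsEnergy [Nonempty S] (ha : ∀ σ i, |a σ i| ≤ 1) (hb : ∀ σ, |b σ| ≤ A)
    (v : ι → ℝ≥0) (β : ℝ) : Integrable (fun x => gibbsEnergy a b β x) (gaussianPi v) :=
  (integrable_const_add_sum_abs v A).mono'
    (continuous_gibbsEnergy.comp (Continuous.prodMk_right β)).aestronglyMeasurable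
    (ae_of_all _ fun x => abs_gibbsEnergy_le ha hb β x)

theorem integrable_gibbsAbsDev [Nonempty S] (ha : ∀ σ i, |a σ i| ≤ 1) (hb : ∀ σ, |b σ| ≤ A)
    (v : ι → ℝ≥0) (β : ℝ) : Integrable (fun x => gibbsAbsDev a b β x) (gaussianPi v) :=
  ((integrable_const_add_sum_abs v A).const_mul 2).mono'
    (continuous_gibbsAbsDev.comp (Continuous.prodMk_right β)).aestronglyMeasurable
    (ae_of_all _ fun x => abs_gibbsAbsDev_le ha hb β x)

theorem integrable_gibbsVar [Nonempty S] (ha : ∀ σ i, |a σ i| ≤ 1) (hb : ∀ σ, |b σ| ≤ A)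
    (v : ι → ℝ≥0) (β : ℝ) : Integrable (fun x => gibbsVar a b β x) (gaussianPi v) :=
  ((memLp_const_add_sum_abs_gaussianPi v A).integrable_sq.const_mul 4).mono'
    (continuous_gibbsVar.comp (Continuous.prodMk_right β)).aestronglyMeasurable
    (ae_of_all _ fun x => abs_gibbsVar_le ha hb β x)

theorem continuous_quenchedEnergy [Nonempty S] (ha : ∀ σ i, |a σ i| ≤ 1) (hb : ∀ σ, |b σ| ≤ A)
    (v : ι → ℝ≥0) : Continuous (quenchedEnergy a b v) :=
  continuous_integral_of_continuous_of_le continuous_gibbsEnergy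
    (integrable_const_add_sum_abs v A) (abs_gibbsEnergy_le ha hb)

/-- The quenched energy is controlled by the means and the variances of the couplings. -/
theorem abs_quenchedEnergy_le [Nonempty S] (ha : ∀ σ i, |a σ i| ≤ 1) (hb : ∀ σ, |b σ| ≤ A)
    (v : ι → ℝ≥0) (β : ℝ) :
    |quenchedEnergy a b v β| ≤ A + 2 * |β| * ∑ i, (v i : ℝ) := by
  -- Integration by parts with one replica and the observable 1 trades the unbounded energy for
  -- means and covariances. The direct bound by the expectation of ∑ |x i| would involve the sum of
  -- the standard deviations, which stability does not control.
  have h := integral_replicaAvg_energy (κ := Unit) (b := b) ha v β () (fun _ => 1)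
  simp only [mul_one] at h
  have h1 : ∀ x, replicaAvg (logBoltzmann a b β x) (fun s : Unit → S => energy a b x (s ()))
      = gibbsEnergy a b β x := fun x => replicaAvg_eval _ () (energy a b x)
  simp only [h1] at h
  rw [quenchedEnergy, h]
  have hpt : ∀ x, ‖replicaAvg (logBoltzmann a b β x) (fun s : Unit → S => b (s ()) - β * (∑ k,
      energyCov a v (s ()) (s k) - Fintype.card Unit
        * softmaxAvg (logBoltzmann a b β x) (energyCov a v (s ()))))‖
      ≤ A + 2 * |β| * ∑ i, (v i : ℝ) := by
    intro x
    refine abs_replicaAvg_le_of_le _ fun s => ?_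
    simp only [Finset.univ_unique, Finset.sum_singleton, Fintype.card_unit, Nat.cast_one, one_mul]
    refine (abs_sub _ _).trans ?_
    rw [abs_mul]
    have h2 := abs_softmaxAvg_le (logBoltzmann a b β x) (abs_energyCov_le ha v (s ()))
    have h3 := abs_energyCov_le ha v (s ()) (s default)
    have h4 := mul_le_mul_of_nonneg_left ((abs_sub _ _).trans (add_le_add h3 h2)) (abs_nonneg β)
    linarith [hb (s ())]
  have := norm_integral_le_of_norm_le_const (μ := gaussianPi v) (ae_of_all _ hpt)
  rwa [probReal_univ, mul_one] at this

theorem gibbsVar_eq [Nonempty S] (β : ℝ) (x : ι → ℝ) :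
    gibbsVar a b β x = softmaxAvg (logBoltzmann a b β x) (fun σ => energy a b x σ * energy a b x σ)
      - gibbsEnergy a b β x * gibbsEnergy a b β x := by
  set m := gibbsEnergy a b β x with hm
  have h : ∀ σ, (energy a b x σ - m) ^ 2
      = energy a b x σ * energy a b x σ - (2 * m * energy a b x σ - m ^ 2) := fun σ => by ring
  unfold gibbsVar
  simp only [← hm, h]
  rw [softmaxAvg_sub, softmaxAvg_sub, softmaxAvg_const_mul, softmaxAvg_const]
  change _ - (2 * m * m - m ^ 2) = _
  ring

theorem hasDerivAt_gibbsEnergy [Nonempty S] (x : ι → ℝ) (β : ℝ) :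
    HasDerivAt (fun β => gibbsEnergy a b β x) (-gibbsVar a b β x) β := by
  refine (hasDerivAt_softmaxAvg (φ := energy a b x)
    (fun σ => hasDerivAt_logBoltzmann_beta (a := a) (b := b) x β σ)).congr_deriv ?_
  rw [gibbsVar_eq]
  have h1 := softmaxAvg_const_mul (logBoltzmann a b β x) (energy a b x) (-1)
  have h2 := softmaxAvg_const_mul (logBoltzmann a b β x)
    (fun σ => energy a b x σ * energy a b x σ) (-1)
  simp only [neg_mul, one_mul] at h1 h2 ⊢
  rw [h1, h2, gibbsEnergy]
  ring

/-- The variance is minus the β-derivative of the mean energy. Its integral therefore sees only the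
quenched energies at the endpoints, whatever happens at individual temperatures. -/
theorem integral_integral_gibbsVar [Nonempty S] (ha : ∀ σ i, |a σ i| ≤ 1) (hb : ∀ σ, |b σ| ≤ A)
    (v : ι → ℝ≥0) (β₁ β₂ : ℝ) :
    ∫ β in β₁..β₂, ∫ x, gibbsVar a b β x ∂gaussianPi v
      = quenchedEnergy a b v β₁ - quenchedEnergy a b v β₂ := by
  rw [intervalIntegral_integral_comm continuous_gibbsVar
    ((memLp_const_add_sum_abs_gaussianPi v A).integrable_sq.const_mul 4) (abs_gibbsVar_le ha hb)]
  have h : ∀ x, ∫ β in β₁..β₂, gibbsVar a b β x = gibbsEnergy a b β₁ x - gibbsEnergy a b β₂ x := by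
    intro x
    have hc : Continuous fun β => gibbsVar a b β x :=
      continuous_gibbsVar.comp (Continuous.prodMk_left x)
    have := intervalIntegral.integral_eq_sub_of_hasDerivAt (a := β₁) (b := β₂)
      (fun β _ => hasDerivAt_gibbsEnergy (a := a) (b := b) x β)
      (hc.neg.intervalIntegrable _ _)
    rw [intervalIntegral.integral_neg] at this
    linarith
  simp only [h]
  exact integral_sub (integrable_gibbsEnergy ha hb v β₁) (integrable_gibbsEnergy ha hb v β₂)

theorem continuous_integral_gibbsAbsDev [Nonempty S] (ha : ∀ σ i, |a σ i| ≤ 1)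
    (hb : ∀ σ, |b σ| ≤ A) (v : ι → ℝ≥0) :
    Continuous fun β => ∫ x, gibbsAbsDev a b β x ∂gaussianPi v :=
  continuous_integral_of_continuous_of_le continuous_gibbsAbsDev
    ((integrable_const_add_sum_abs v A).const_mul 2) (abs_gibbsAbsDev_le ha hb)

/-- The thermal fluctuations of the energy are small on average over the inverse temperature. -/
theorem integral_gibbsAbsDev_le [Nonempty S] (ha : ∀ σ i, |a σ i| ≤ 1) (hb : ∀ σ, |b σ| ≤ A)
    (v : ι → ℝ≥0) {β₁ β₂ t : ℝ} (hβ : β₁ ≤ β₂) (ht : 0 < t) :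
    ∫ β in β₁..β₂, ∫ x, gibbsAbsDev a b β x ∂gaussianPi v
      ≤ (t * (2 * A + 2 * (|β₁| + |β₂|) * ∑ i, (v i : ℝ)) + t⁻¹ * (β₂ - β₁)) / 2 := by
  have hvc : Continuous fun β => ∫ x, gibbsVar a b β x ∂gaussianPi v :=
    continuous_integral_of_continuous_of_le continuous_gibbsVar
      ((memLp_const_add_sum_abs_gaussianPi v A).integrable_sq.const_mul 4) (abs_gibbsVar_le ha hb)
  have hpt : ∀ β, ∫ x, gibbsAbsDev a b β x ∂gaussianPi v
      ≤ t / 2 * ∫ x, gibbsVar a b β x ∂gaussianPi v + t⁻¹ / 2 := by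
    intro β
    have hi := (integrable_gibbsVar ha hb v β).const_mul (t / 2)
    have : ∫ x, (t / 2 * gibbsVar a b β x + t⁻¹ / 2) ∂gaussianPi v
        = t / 2 * ∫ x, gibbsVar a b β x ∂gaussianPi v + t⁻¹ / 2 := by
      rw [integral_add hi (integrable_const _), integral_const_mul]; simp
    rw [← this]
    refine integral_mono (integrable_gibbsAbsDev ha hb v β) (hi.add (integrable_const _))
      fun x => ?_
    have h1 : gibbsAbsDev a b β x ≤ softmaxAvg (logBoltzmann a b β x)
        (fun σ => t / 2 * (energy a b x σ - gibbsEnergy a b β x) ^ 2 + t⁻¹ / 2) :=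
      softmaxAvg_mono fun σ => by
        have := abs_le_mul_sq_add_inv ht (energy a b x σ - gibbsEnergy a b β x)
        linarith
    rw [softmaxAvg_add _ (fun σ => t / 2 * (energy a b x σ - gibbsEnergy a b β x) ^ 2)
      (fun _ => t⁻¹ / 2), softmaxAvg_const_mul, softmaxAvg_const] at h1
    exact h1
  have hmono : ∫ β in β₁..β₂, ∫ x, gibbsAbsDev a b β x ∂gaussianPi v
      ≤ ∫ β in β₁..β₂, (t / 2 * ∫ x, gibbsVar a b β x ∂gaussianPi v + t⁻¹ / 2) :=
    intervalIntegral.integral_mono_on hβ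
      ((continuous_integral_gibbsAbsDev ha hb v).intervalIntegrable _ _)
      (((hvc.const_mul (t / 2)).add continuous_const).intervalIntegrable _ _) fun β _ => hpt β
  rw [intervalIntegral.integral_add ((hvc.const_mul (t / 2)).intervalIntegrable _ _)
    (continuous_const.intervalIntegrable _ _), intervalIntegral.integral_const_mul,
    integral_integral_gibbsVar ha hb v, intervalIntegral.integral_const, smul_eq_mul] at hmono
  have e1 := (abs_le.1 (abs_quenchedEnergy_le ha hb v β₁)).2
  have e2 := (abs_le.1 (abs_quenchedEnergy_le ha hb v β₂)).1
  have e3 : quenchedEnergy a b v β₁ - quenchedEnergy a b v β₂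
      ≤ 2 * A + 2 * (|β₁| + |β₂|) * ∑ i, (v i : ℝ) := by linarith
  have e4 := mul_le_mul_of_nonneg_left e3 (half_pos ht).le
  linarith

/-- Each coupling enters the energy with a coefficient of absolute value at most 1. The sum over
`Finset.univ` matches the hypothesis of `integral_sub_sq_le_sum`. -/
theorem abs_logPartition_sub_le [Nonempty S] (ha : ∀ σ i, |a σ i| ≤ 1) (β : ℝ) (x y : ι → ℝ) :
    |logPartition a b β x - logPartition a b β y| ≤ |β| * ∑ i ∈ Finset.univ, |x i - y i| := by
  refine abs_log_sum_exp_sub_le fun σ => ?_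
  have : logBoltzmann a b β x σ - logBoltzmann a b β y σ
      = -β * (energy a b x σ - energy a b y σ) := by
    simp only [logBoltzmann]; ring
  rw [this, abs_mul, abs_neg]
  exact mul_le_mul_of_nonneg_left (abs_energy_sub_le ha x y σ) (abs_nonneg β)

theorem memLp_logPartition [Nonempty S] (ha : ∀ σ i, |a σ i| ≤ 1) (v : ι → ℝ≥0) (β : ℝ) :
    MemLp (logPartition a b β) 2 (gaussianPi v) :=
  memLp_of_sum_abs v (abs_logPartition_sub_le ha β)

theorem integrable_logPartition [Nonempty S] (ha : ∀ σ i, |a σ i| ≤ 1) (v : ι → ℝ≥0) (β : ℝ) :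
    Integrable (logPartition a b β) (gaussianPi v) :=
  (memLp_logPartition ha v β).integrable one_le_two

/-- Self-averaging of the pressure. -/
theorem integral_abs_logPartition_sub_le [Nonempty S] (ha : ∀ σ i, |a σ i| ≤ 1) (v : ι → ℝ≥0)
    {β B t : ℝ} (hB : |β| ≤ B) (ht : 0 < t) :
    ∫ x, |logPartition a b β x - quenchedPressure a b v β| ∂gaussianPi v
      ≤ (t * (B ^ 2 * ∑ i, (v i : ℝ)) + t⁻¹) / 2 := by
  have h2 : MemLp (fun x => logPartition a b β x - quenchedPressure a b v β) 2 (gaussianPi v) :=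
    (memLp_logPartition ha v β).sub (memLp_const _)
  have hvar := integral_sub_sq_le_sum v |β| Finset.univ (logPartition a b β)
    (abs_logPartition_sub_le ha β)
  have hi : Integrable (fun x => t / 2 * (logPartition a b β x - quenchedPressure a b v β) ^ 2)
      (gaussianPi v) := h2.integrable_sq.const_mul _
  have hmono : ∫ x, |logPartition a b β x - quenchedPressure a b v β| ∂gaussianPi v
      ≤ ∫ x, (t / 2 * (logPartition a b β x - quenchedPressure a b v β) ^ 2 + t⁻¹ / 2)
        ∂gaussianPi v :=
    integral_mono (h2.integrable one_le_two).abs (hi.add (integrable_const _)) fun x => by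
      have := abs_le_mul_sq_add_inv ht (logPartition a b β x - quenchedPressure a b v β)
      simp only
      linarith
  rw [integral_add hi (integrable_const _), integral_const_mul] at hmono
  have hBB : |β| ^ 2 ≤ B ^ 2 := pow_le_pow_left₀ (abs_nonneg _) hB 2
  have hV : 0 ≤ ∑ i, (v i : ℝ) := Finset.sum_nonneg fun i _ => (v i).2
  have h3 := mul_le_mul_of_nonneg_left
    (hvar.trans (mul_le_mul_of_nonneg_right hBB hV)) (half_pos ht).le
  change t / 2 * ∫ x, (logPartition a b β x - quenchedPressure a b v β) ^ 2 ∂gaussianPi v ≤ _ at h3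
  simp only [integral_const, probReal_univ, one_smul] at hmono
  linarith

/-- Convexity of the pressure in the inverse temperature. -/
theorem neg_mul_gibbsEnergy_le [Nonempty S] (β δ : ℝ) (x : ι → ℝ) :
    -δ * gibbsEnergy a b β x ≤ logPartition a b (β + δ) x - logPartition a b β x := by
  -- Perturbing by −δH moves β to β + δ. As δ may have either sign, minus the Gibbs energy is a
  -- subgradient of the log-partition function.
  have h := softmaxAvg_le_log_sub_log (logBoltzmann a b β x) (fun σ => -δ * energy a b x σ)
  rw [softmaxAvg_const_mul] at h
  have h1 : ∀ σ, logBoltzmann a b β x σ + -δ * energy a b x σ = logBoltzmann a b (β + δ) x σ :=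
    fun σ => by simp only [logBoltzmann]; ring
  simp only [h1] at h
  exact h

/-- The subgradient inequality survives averaging over the couplings, so the quenched pressure never
has to be differentiated. -/
theorem neg_mul_quenchedEnergy_le [Nonempty S] (ha : ∀ σ i, |a σ i| ≤ 1) (hb : ∀ σ, |b σ| ≤ A)
    (v : ι → ℝ≥0) (β δ : ℝ) :
    -δ * quenchedEnergy a b v β
      ≤ quenchedPressure a b v (β + δ) - quenchedPressure a b v β := by
  unfold quenchedEnergy quenchedPressure
  rw [← integral_const_mul, ← integral_sub (integrable_logPartition ha v _)
    (integrable_logPartition ha v _)]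
  exact integral_mono ((integrable_gibbsEnergy ha hb v β).const_mul _)
    ((integrable_logPartition ha v _).sub (integrable_logPartition ha v _))
    fun x => neg_mul_gibbsEnergy_le β δ x

/-- The subgradient at β alone gives this side, so only β has to lie in the range bounded by B.
Exchanging the two temperatures gives the full Lipschitz bound. -/
theorem quenchedPressure_sub_le [Nonempty S] (ha : ∀ σ i, |a σ i| ≤ 1) (hb : ∀ σ, |b σ| ≤ A)
    (v : ι → ℝ≥0) {β β' B : ℝ} (hB : |β| ≤ B) :
    quenchedPressure a b v β - quenchedPressure a b v β'
      ≤ |β' - β| * (A + 2 * B * ∑ i, (v i : ℝ)) := by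
  have h := neg_mul_quenchedEnergy_le ha hb v β (β' - β)
  have hV : 0 ≤ ∑ i, (v i : ℝ) := Finset.sum_nonneg fun i _ => (v i).2
  have hE : |quenchedEnergy a b v β| ≤ A + 2 * B * ∑ i, (v i : ℝ) := by
    have := mul_le_mul_of_nonneg_right hB hV
    linarith [abs_quenchedEnergy_le ha hb v β]
  have h1 : (β' - β) * quenchedEnergy a b v β ≤ |β' - β| * (A + 2 * B * ∑ i, (v i : ℝ)) := by
    refine (le_abs_self _).trans ?_
    rw [abs_mul]
    exact mul_le_mul_of_nonneg_left hE (abs_nonneg _)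
  rw [add_sub_cancel] at h
  linarith

theorem abs_quenchedPressure_sub_le [Nonempty S] (ha : ∀ σ i, |a σ i| ≤ 1) (hb : ∀ σ, |b σ| ≤ A)
    (v : ι → ℝ≥0) {β β' B : ℝ} (hB : |β| ≤ B) (hB' : |β'| ≤ B) :
    |quenchedPressure a b v β - quenchedPressure a b v β'|
      ≤ |β - β'| * (A + 2 * B * ∑ i, (v i : ℝ)) := by
  rw [abs_sub_le_iff]
  refine ⟨?_, quenchedPressure_sub_le ha hb v hB'⟩
  rw [abs_sub_comm]
  exact quenchedPressure_sub_le ha hb v hB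

theorem continuous_quenchedPressure [Nonempty S] (ha : ∀ σ i, |a σ i| ≤ 1)
    (hb : ∀ σ, |b σ| ≤ A) (v : ι → ℝ≥0) : Continuous (quenchedPressure a b v) := by
  rw [continuous_iff_continuousAt]
  intro β
  rw [ContinuousAt, tendsto_iff_dist_tendsto_zero]
  have hlim : Tendsto (fun β' => |β' - β| * (A + 2 * (|β| + 1) * ∑ i, (v i : ℝ))) (𝓝 β) (𝓝 0) := by
    have : Continuous fun β' => |β' - β| * (A + 2 * (|β| + 1) * ∑ i, (v i : ℝ)) := by fun_prop
    simpa using this.tendsto β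
  refine squeeze_zero' (Eventually.of_forall fun _ => dist_nonneg) ?_ hlim
  have hev : ∀ᶠ β' in 𝓝 β, |β'| < |β| + 1 :=
    (continuous_abs.tendsto β).eventually_lt_const (lt_add_one _)
  filter_upwards [hev] with β' hβ'
  exact abs_quenchedPressure_sub_le ha hb v hβ'.le (by linarith)

/-- The second difference is g(β) − g(β − δ) for the first difference g, so its integral collapses
to integrals of g over two end intervals of length δ. There g is at most δ times the Lipschitz
constant, hence the factor δ². -/
theorem integral_second_difference_le [Nonempty S] (ha : ∀ σ i, |a σ i| ≤ 1)
    (hb : ∀ σ, |b σ| ≤ A) (v : ι → ℝ≥0) {β₁ β₂ δ B : ℝ} (hδ : 0 < δ)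
    (hB₁ : |β₁| + δ ≤ B) (hB₂ : |β₂| + δ ≤ B) :
    ∫ β in β₁..β₂, (quenchedPressure a b v (β - δ) + quenchedPressure a b v (β + δ)
        - 2 * quenchedPressure a b v β) ≤ 2 * δ ^ 2 * (A + 2 * B * ∑ i, (v i : ℝ)) := by
  set f := quenchedPressure a b v with hf
  have hfc : Continuous f := continuous_quenchedPressure ha hb v
  set g : ℝ → ℝ := fun β => f (β + δ) - f β with hg
  have hgc : Continuous g := by fun_prop
  have hgi : ∀ c d, IntervalIntegrable g volume c d := fun c d => hgc.intervalIntegrable c d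
  have h1 : ∀ β, f (β - δ) + f (β + δ) - 2 * f β = g β - g (β - δ) := fun β => by
    simp only [hg, sub_add_cancel]; ring
  simp only [h1]
  have hgc' : Continuous fun β => g (β - δ) := by fun_prop
  rw [intervalIntegral.integral_sub (hgi _ _) (hgc'.intervalIntegrable _ _),
    intervalIntegral.integral_comp_sub_right,
    intervalIntegral.integral_interval_sub_interval_comm (hgi _ _) (hgi _ _) (hgi _ _)]
  have hbound : ∀ β, |β| + δ ≤ B → |∫ x in β..(β - δ), g x|
      ≤ δ * (A + 2 * B * ∑ i, (v i : ℝ)) * δ := by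
    intro β hβB
    have := intervalIntegral.norm_integral_le_of_norm_le_const (a := β) (b := β - δ) (f := g)
      (C := δ * (A + 2 * B * ∑ i, (v i : ℝ))) fun y hy => ?_
    · simpa [abs_of_pos hδ] using this
    · rw [Set.uIoc_of_ge (by linarith), Set.mem_Ioc] at hy
      have b1 := abs_le.1 (show |β| ≤ B - δ by linarith)
      have := abs_quenchedPressure_sub_le ha hb v (β := y + δ) (β' := y) (B := B)
        (abs_le.2 ⟨by linarith, by linarith⟩) (abs_le.2 ⟨by linarith, by linarith⟩)
      simpa [abs_of_pos hδ] using this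
  have k1 := (abs_le.1 (hbound β₁ hB₁)).2
  have k2 := (abs_le.1 (hbound β₂ hB₂)).1
  nlinarith

theorem continuous_integral_abs_gibbsEnergy_sub [Nonempty S] (ha : ∀ σ i, |a σ i| ≤ 1)
    (hb : ∀ σ, |b σ| ≤ A) (v : ι → ℝ≥0) :
    Continuous fun β => ∫ x, |gibbsEnergy a b β x - quenchedEnergy a b v β| ∂gaussianPi v := by
  have hq : ∀ β, |quenchedEnergy a b v β| ≤ ∫ x, (A + ∑ i, |x i|) ∂gaussianPi v := fun β =>
    norm_integral_le_of_norm_le (f := fun x => gibbsEnergy a b β x) (integrable_const_add_sum_abs v A)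
      (ae_of_all _ fun x => abs_gibbsEnergy_le ha hb β x)
  refine continuous_integral_of_continuous_of_le
    (F := fun β x => |gibbsEnergy a b β x - quenchedEnergy a b v β|)
    (g := fun x => (A + ∑ i, |x i|) + ∫ x, (A + ∑ i, |x i|) ∂gaussianPi v)
    (continuous_gibbsEnergy.sub ((continuous_quenchedEnergy ha hb v).comp continuous_fst)).abs
    ((integrable_const_add_sum_abs v A).add (integrable_const _)) fun β x => ?_
  rw [abs_abs]
  exact (abs_sub _ _).trans (add_le_add (abs_gibbsEnergy_le ha hb β x) (hq β))

/-- The disorder fluctuations of the Gibbs energy are small on average over the inverse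
temperature. -/
theorem integral_abs_gibbsEnergy_sub_le [Nonempty S] (ha : ∀ σ i, |a σ i| ≤ 1)
    (hb : ∀ σ, |b σ| ≤ A) (v : ι → ℝ≥0) {β₁ β₂ δ B t : ℝ} (hβ : β₁ ≤ β₂) (hδ : 0 < δ)
    (hB₁ : |β₁| + δ ≤ B) (hB₂ : |β₂| + δ ≤ B) (ht : 0 < t) :
    ∫ β in β₁..β₂, ∫ x, |gibbsEnergy a b β x - quenchedEnergy a b v β| ∂gaussianPi v
      ≤ δ⁻¹ * ((β₂ - β₁) * (3 * ((t * (B ^ 2 * ∑ i, (v i : ℝ)) + t⁻¹) / 2)))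
        + 2 * δ * (A + 2 * B * ∑ i, (v i : ℝ)) := by
  set f := quenchedPressure a b v with hf
  set ε := (t * (B ^ 2 * ∑ i, (v i : ℝ)) + t⁻¹) / 2 with hε
  have hfc : Continuous f := continuous_quenchedPressure ha hb v
  have hui : ∀ β, Integrable (fun x => |logPartition a b β x - f β|) (gaussianPi v) := fun β =>
    ((integrable_logPartition ha v β).sub (integrable_const _)).abs
  -- Convexity: the subgradient inequality of the random pressure on one side of β is combined with
  -- that of the quenched pressure on the other side. The discrepancies between the two pressures
  -- and the second difference of the quenched one remain.
  have hpt : ∀ β x, δ * |gibbsEnergy a b β x - quenchedEnergy a b v β|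
      ≤ |logPartition a b (β - δ) x - f (β - δ)| + |logPartition a b β x - f β|
        + |logPartition a b (β + δ) x - f (β + δ)| + (f (β - δ) + f (β + δ) - 2 * f β) := by
    intro β x
    have a1 := neg_mul_gibbsEnergy_le (a := a) (b := b) β δ x
    have a2 := neg_mul_gibbsEnergy_le (a := a) (b := b) β (-δ) x
    have a3 := neg_mul_quenchedEnergy_le ha hb v β δ
    have a4 := neg_mul_quenchedEnergy_le ha hb v β (-δ)
    rw [neg_neg, ← sub_eq_add_neg] at a2 a4
    rw [← hf] at a3 a4
    have u1 := abs_le.1 (le_refl |logPartition a b (β - δ) x - f (β - δ)|)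
    have u2 := abs_le.1 (le_refl |logPartition a b β x - f β|)
    have u3 := abs_le.1 (le_refl |logPartition a b (β + δ) x - f (β + δ)|)
    have u4 := abs_nonneg (logPartition a b (β - δ) x - f (β - δ))
    have u5 := abs_nonneg (logPartition a b (β + δ) x - f (β + δ))
    rw [← abs_of_pos hδ, ← abs_mul, abs_of_pos hδ, abs_le, mul_sub]
    constructor <;> linarith
  have hE : ∀ β, Integrable (fun x => |gibbsEnergy a b β x - quenchedEnergy a b v β|)
      (gaussianPi v) := fun β =>
    ((integrable_gibbsEnergy ha hb v β).sub (integrable_const _)).abs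
  have hint : ∀ β ∈ Set.Icc β₁ β₂,
      ∫ x, |gibbsEnergy a b β x - quenchedEnergy a b v β| ∂gaussianPi v
      ≤ δ⁻¹ * (3 * ε + (f (β - δ) + f (β + δ) - 2 * f β)) := by
    intro β hβm
    rw [le_inv_mul_iff₀ hδ, ← integral_const_mul]
    have habs : |β| ≤ B - δ := by
      refine (abs_le_max_abs_abs hβm.1 hβm.2).trans (max_le ?_ ?_) <;> linarith
    have habs' := abs_le.1 habs
    have hle := integral_mono ((hE β).const_mul δ)
      ((((hui (β - δ)).add (hui β)).add (hui (β + δ))).add (integrable_const _)) (hpt β)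
    refine hle.trans ?_
    rw [integral_add' (((hui (β - δ)).add (hui β)).add (hui (β + δ))) (integrable_const _),
      integral_add' ((hui (β - δ)).add (hui β)) (hui (β + δ)),
      integral_add' (hui (β - δ)) (hui β)]
    have e1 := integral_abs_logPartition_sub_le (a := a) (b := b) ha v (β := β - δ) (B := B)
      (abs_le.2 ⟨by linarith, by linarith⟩) ht
    have e2 := integral_abs_logPartition_sub_le (a := a) (b := b) ha v (β := β) (B := B)
      (abs_le.2 ⟨by linarith, by linarith⟩) ht
    have e3 := integral_abs_logPartition_sub_le (a := a) (b := b) ha v (β := β + δ) (B := B)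
      (abs_le.2 ⟨by linarith, by linarith⟩) ht
    rw [← hf, ← hε] at e1 e2 e3
    simp only [integral_const, probReal_univ, one_smul]
    linarith
  have hfc2 : Continuous fun β => f (β - δ) + f (β + δ) - 2 * f β := by fun_prop
  have hrc : Continuous fun β => δ⁻¹ * (3 * ε + (f (β - δ) + f (β + δ) - 2 * f β)) :=
    continuous_const.mul (continuous_const.add hfc2)
  have hmono := intervalIntegral.integral_mono_on (μ := volume) hβ
    ((continuous_integral_abs_gibbsEnergy_sub ha hb v).intervalIntegrable _ _)
    (hrc.intervalIntegrable _ _) hint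
  refine hmono.trans ?_
  rw [intervalIntegral.integral_const_mul, intervalIntegral.integral_add
    intervalIntegrable_const (hfc2.intervalIntegrable _ _),
    intervalIntegral.integral_const, smul_eq_mul, mul_add]
  have h2 := mul_le_mul_of_nonneg_left
    (integral_second_difference_le ha hb v hδ hB₁ hB₂) (inv_pos.2 hδ).le
  refine add_le_add le_rfl (h2.trans (le_of_eq ?_))
  field_simp

end Fluctuations

/-! ### Quenched averages of the energy against an observable -/

section QuenchedState

variable {S ι : Type*} [Fintype ι] [Fintype S] [Nonempty S] {κ : Type*} [Fintype κ]
  [DecidableEq κ] {a : S → ι → ℝ} {b : S → ℝ} {A : ℝ}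

theorem quenchedAvg_add (v : ι → ℝ≥0) (β : ℝ) (O O' : (κ → S) → ℝ) :
    quenchedAvg a b v β (fun s => O s + O' s)
      = quenchedAvg a b v β O + quenchedAvg a b v β O' := by
  simp only [quenchedAvg, replicaAvg_add]
  exact integral_add (integrable_replicaAvg v β O) (integrable_replicaAvg v β O')

theorem quenchedAvg_sub (v : ι → ℝ≥0) (β : ℝ) (O O' : (κ → S) → ℝ) :
    quenchedAvg a b v β (fun s => O s - O' s)
      = quenchedAvg a b v β O - quenchedAvg a b v β O' := by
  simp only [quenchedAvg, replicaAvg_sub]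
  exact integral_sub (integrable_replicaAvg v β O) (integrable_replicaAvg v β O')

theorem quenchedAvg_const_mul {S : Type*} [Fintype S] {a : S → ι → ℝ} {b : S → ℝ} (v : ι → ℝ≥0) (β c : ℝ) (O : (κ → S) → ℝ) :
    quenchedAvg a b v β (fun s => c * O s) = c * quenchedAvg a b v β O := by
  simp only [quenchedAvg, replicaAvg_const_mul, integral_const_mul]

theorem quenchedAvg_sum {α : Type*} (B : Finset α) (v : ι → ℝ≥0) (β : ℝ)
    (O : α → (κ → S) → ℝ) :
    quenchedAvg a b v β (fun s => ∑ j ∈ B, O j s) = ∑ j ∈ B, quenchedAvg a b v β (O j) := by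
  simp only [quenchedAvg, replicaAvg_sum]
  exact integral_finsetSum _ fun j _ => integrable_replicaAvg v β (O j)

theorem continuous_quenchedAvg (v : ι → ℝ≥0) (O : (κ → S) → ℝ) :
    Continuous fun β => quenchedAvg a b v β O := by
  refine continuous_integral_of_continuous_of_le
    (F := fun β x => replicaAvg (logBoltzmann a b β x) O) (g := fun _ => ∑ s, |O s|)
    (continuous_replicaAvg continuous_logBoltzmann_uncurry fun s => continuous_const)
    (integrable_const _) fun β x => ?_
  exact abs_replicaAvg_le_of_le _ fun s =>
    Finset.single_le_sum (f := fun s => |O s|) (fun _ _ => abs_nonneg _) (Finset.mem_univ s)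

/-- The quenched expectation of the energy of the replica `k` times an observable. -/
def energyAvg (a : S → ι → ℝ) (b : S → ℝ) (v : ι → ℝ≥0) (β : ℝ) (k : κ) (O : (κ → S) → ℝ) : ℝ :=
  ∫ x, replicaAvg (logBoltzmann a b β x) (fun s => energy a b x (s k) * O s) ∂gaussianPi v

theorem integrable_replicaAvg_energy (ha : ∀ σ i, |a σ i| ≤ 1) (hb : ∀ σ, |b σ| ≤ A)
    (v : ι → ℝ≥0) (β : ℝ) (k : κ) {C : ℝ} (O : (κ → S) → ℝ) (hO : ∀ s, |O s| ≤ C) :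
    Integrable (fun x => replicaAvg (logBoltzmann a b β x)
      (fun s => energy a b x (s k) * O s)) (gaussianPi v) := by
  refine integrable_of_continuous_of_le_mul_const_add_sum_abs v (A := A) (K := C)
    (continuous_replicaAvg (continuous_logBoltzmann β) fun s =>
      (continuous_energy (s k)).mul continuous_const) fun x => ?_
  refine abs_replicaAvg_le_of_le _ fun s => ?_
  rw [abs_mul, mul_comm C]
  have h := abs_energy_le ha hb x (s k)
  exact mul_le_mul h (hO s) (abs_nonneg _) ((abs_nonneg _).trans h)

/-- Once the observable is replaced by its bound, only the replica k is left and the others sum out.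
-/
theorem abs_replicaAvg_sub_mul_le (x : S → ℝ) (h : S → ℝ)
    (m : ℝ) (k : κ) {C : ℝ} {O : (κ → S) → ℝ} (hO : ∀ s, |O s| ≤ C) :
    |replicaAvg x (fun s => (h (s k) - m) * O s)| ≤ C * softmaxAvg x (fun σ => |h σ - m|) := by
  refine (abs_replicaAvg_le _ _).trans ?_
  rw [← replicaAvg_eval x k, ← replicaAvg_const_mul]
  refine replicaAvg_mono fun s => ?_
  rw [abs_mul, mul_comm]
  exact mul_le_mul_of_nonneg_right (hO s) (abs_nonneg _)

theorem replicaAvg_sub_const_mul {S : Type*} [Fintype S] (x : S → ℝ) (h : S → ℝ) (m : ℝ) (k : κ) (O : (κ → S) → ℝ) :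
    replicaAvg x (fun s => (h (s k) - m) * O s)
      = replicaAvg x (fun s => h (s k) * O s) - m * replicaAvg x O := by
  rw [← replicaAvg_const_mul, ← replicaAvg_sub]
  congr 1; ext s; ring

/-- For given couplings both replicas can be centred at the same Gibbs energy, which cancels in the
difference. Disorder fluctuations do not enter. -/
theorem abs_energyAvg_sub_le (ha : ∀ σ i, |a σ i| ≤ 1) (hb : ∀ σ, |b σ| ≤ A) (v : ι → ℝ≥0)
    (β : ℝ) (k l : κ) {C : ℝ} {O : (κ → S) → ℝ} (hO : ∀ s, |O s| ≤ C) :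
    |energyAvg a b v β k O - energyAvg a b v β l O|
      ≤ 2 * C * ∫ x, gibbsAbsDev a b β x ∂gaussianPi v := by
  unfold energyAvg
  rw [← integral_sub (integrable_replicaAvg_energy ha hb v β k O hO)
    (integrable_replicaAvg_energy ha hb v β l O hO), ← integral_const_mul]
  rw [← Real.norm_eq_abs]
  refine norm_integral_le_of_norm_le ((integrable_gibbsAbsDev ha hb v β).const_mul _)
    (ae_of_all _ fun x => ?_)
  have h1 := abs_replicaAvg_sub_mul_le (logBoltzmann a b β x) (energy a b x)
    (gibbsEnergy a b β x) k hO
  have h2 := abs_replicaAvg_sub_mul_le (logBoltzmann a b β x) (energy a b x)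
    (gibbsEnergy a b β x) l hO
  rw [replicaAvg_sub_const_mul] at h1 h2
  change _ ≤ C * gibbsAbsDev a b β x at h1
  change _ ≤ C * gibbsAbsDev a b β x at h2
  rw [abs_le] at h1 h2
  rw [Real.norm_eq_abs, abs_le]
  constructor <;> linarith

/-- Here the centring is at the deterministic quenched energy, and the triangle inequality through
the Gibbs energy separates thermal from disorder fluctuations. -/
theorem abs_energyAvg_sub_mul_le (ha : ∀ σ i, |a σ i| ≤ 1) (hb : ∀ σ, |b σ| ≤ A) (v : ι → ℝ≥0)
    (β : ℝ) (k : κ) {C : ℝ} {O : (κ → S) → ℝ} (hO : ∀ s, |O s| ≤ C) :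
    |energyAvg a b v β k O - quenchedEnergy a b v β * quenchedAvg a b v β O|
      ≤ C * (∫ x, gibbsAbsDev a b β x ∂gaussianPi v
        + ∫ x, |gibbsEnergy a b β x - quenchedEnergy a b v β| ∂gaussianPi v) := by
  have hE : Integrable (fun x => |gibbsEnergy a b β x - quenchedEnergy a b v β|)
      (gaussianPi v) := ((integrable_gibbsEnergy ha hb v β).sub (integrable_const _)).abs
  have hD := integrable_gibbsAbsDev ha hb v β
  unfold energyAvg quenchedAvg
  rw [← integral_const_mul, ← integral_sub (integrable_replicaAvg_energy ha hb v β k O hO)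
    ((integrable_replicaAvg v β O).const_mul _), ← integral_add hD hE, ← integral_const_mul]
  rw [← Real.norm_eq_abs]
  refine norm_integral_le_of_norm_le ((hD.add hE).const_mul _) (ae_of_all _ fun x => ?_)
  rw [← replicaAvg_sub_const_mul, Real.norm_eq_abs]
  refine (abs_replicaAvg_sub_mul_le _ _ _ k hO).trans ?_
  have hC : 0 ≤ C := (abs_nonneg _).trans (hO fun _ => Classical.arbitrary S)
  refine mul_le_mul_of_nonneg_left ?_ hC
  have h1 : softmaxAvg (logBoltzmann a b β x)
      (fun σ => |energy a b x σ - quenchedEnergy a b v β|)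
      ≤ softmaxAvg (logBoltzmann a b β x) (fun σ => |energy a b x σ - gibbsEnergy a b β x|
        + |gibbsEnergy a b β x - quenchedEnergy a b v β|) :=
    softmaxAvg_mono fun σ => abs_sub_le _ _ _
  rwa [softmaxAvg_add _ (fun σ => |energy a b x σ - gibbsEnergy a b β x|)
    (fun _ => |gibbsEnergy a b β x - quenchedEnergy a b v β|), softmaxAvg_const] at h1

theorem energyAvg_one (v : ι → ℝ≥0) (β : ℝ) (k : κ) :
    energyAvg a b v β k (fun _ => 1) = quenchedEnergy a b v β := by
  unfold energyAvg quenchedEnergy gibbsEnergy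
  simp only [mul_one]
  congr 1; ext x
  exact replicaAvg_eval _ k (energy a b x)

/-- Integration by parts for one replica and the observable 1. Allowing any ambient family of
replicas makes the terms comparable with those in `Model.f₂`. -/
theorem quenchedEnergy_eq (ha : ∀ σ i, |a σ i| ≤ 1) (v : ι → ℝ≥0) (β : ℝ) {k l : κ}
    (hkl : k ≠ l) :
    quenchedEnergy a b v β = quenchedAvg a b v β (fun s : κ → S => b (s k))
      - β * (quenchedAvg a b v β (fun s : κ → S => energyCov a v (s k) (s k))
        - quenchedAvg a b v β (fun s : κ → S => energyCov a v (s k) (s l))) := by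
  have h := integral_replicaAvg_energy_embedding (κ := Unit) (b := b) ha v β (e := fun _ => k)
    (Function.injective_of_subsingleton _) (r := l) (fun _ => hkl) () (fun _ => 1)
  rw [← energyAvg_one v β k, energyAvg, h]
  simp

variable {R : ℕ}

/-- The energy of a replica on which the observable depends. -/
theorem energyAvg_castAdd (ha : ∀ σ i, |a σ i| ≤ 1) (v : ι → ℝ≥0) (β : ℝ)
    (g : (Fin R → S) → ℝ) {O : (Fin (R + 2) → S) → ℝ}
    (hO : ∀ s, O s = g (fun k => s (Fin.castAdd 2 k))) (l : Fin R) :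
    energyAvg a b v β (Fin.castAdd 2 l) O
      = quenchedAvg a b v β (fun s => b (s (Fin.castAdd 2 l)) * O s)
        - β * ((∑ k : Fin R, quenchedAvg a b v β (fun s : Fin (R + 2) → S =>
            energyCov a v (s (Fin.castAdd 2 l)) (s (Fin.castAdd 2 k)) * O s))
          - (R : ℝ) * quenchedAvg a b v β (fun s => energyCov a v
            (s (Fin.castAdd 2 l)) (s (Fin.natAdd R (0 : Fin 2))) * O s)) := by
  have h := integral_replicaAvg_energy_embedding (b := b) ha v β
    (e := fun k : Fin R => Fin.castAdd 2 k) (Fin.castAdd_injective R 2)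
    (r := Fin.natAdd R (0 : Fin 2)) (fun k => Fin.ne_of_val_ne (by simp; omega)) l g
  have hO' : ∀ s : Fin (R + 2) → S, g (s ∘ fun k => Fin.castAdd 2 k) = O s := fun s => (hO s).symm
  simp only [hO', Fintype.card_fin] at h
  exact h

/-- The energy of a replica on which the observable does not depend. -/
theorem energyAvg_natAdd (ha : ∀ σ i, |a σ i| ≤ 1) (v : ι → ℝ≥0) (β : ℝ)
    (g : (Fin R → S) → ℝ) {O : (Fin (R + 2) → S) → ℝ}
    (hO : ∀ s, O s = g (fun k => s (Fin.castAdd 2 k))) :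
    energyAvg a b v β (Fin.natAdd R (0 : Fin 2)) O
      = quenchedAvg a b v β (fun s => b (s (Fin.natAdd R (0 : Fin 2))) * O s)
        - β * ((∑ k : Fin (R + 1), quenchedAvg a b v β (fun s : Fin (R + 2) → S =>
            energyCov a v (s (Fin.natAdd R (0 : Fin 2))) (s k.castSucc) * O s))
          - ((R : ℝ) + 1) * quenchedAvg a b v β (fun s => energyCov a v
            (s (Fin.natAdd R (0 : Fin 2))) (s (Fin.natAdd R (1 : Fin 2))) * O s)) := by
  -- g is viewed as a function of R + 1 replicas that ignores the last one, whose energy is taken.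
  -- Hence the coefficient R + 1, and the unused replica is number R + 2.
  have h := integral_replicaAvg_energy_embedding (b := b) ha v β
    (e := fun k : Fin (R + 1) => k.castSucc) (Fin.castSucc_injective (R + 1))
    (r := Fin.natAdd R (1 : Fin 2)) (fun k => Fin.ne_of_val_ne (by simp; omega))
    (Fin.last R) (fun s => g (fun k => s k.castSucc))
  have hO' : ∀ s : Fin (R + 2) → S,
      g (fun k : Fin R => (s ∘ fun k : Fin (R + 1) => k.castSucc) k.castSucc) = O s :=
    fun s => (hO s).symm
  simp only [hO', Fintype.card_fin, Nat.cast_add, Nat.cast_one] at h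
  exact h

end QuenchedState

/-! ### Fluctuations per site -/

section ThermodynamicBounds

variable {S ι : Type*} [Fintype ι] [Fintype S] [Nonempty S] {a : S → ι → ℝ} {b : S → ℝ}

/-- With u = N^(-1/4) and weight t = u², the terms tN and 1/t are both of order N^(1/2), that is u²
per site. -/
theorem integral_gibbsAbsDev_div_le (ha : ∀ σ i, |a σ i| ≤ 1) {v : ι → ℝ≥0} {N c u β₁ β₂ : ℝ}
    (hβ : β₁ ≤ β₂) (hu : 0 < u) (hN : N * u ^ 4 = 1) (hb : ∀ σ, |b σ| ≤ c * N)
    (hv : ∑ i, (v i : ℝ) ≤ c * N) :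
    N⁻¹ * ∫ β in β₁..β₂, ∫ x, gibbsAbsDev a b β x ∂gaussianPi v
      ≤ (2 * c + 2 * (|β₁| + |β₂|) * c + (β₂ - β₁)) / 2 * u ^ 2 := by
  have hN' : N = (u ^ 4)⁻¹ := eq_inv_of_mul_eq_one_left hN
  have h := integral_gibbsAbsDev_le ha hb v hβ (t := u ^ 2) (by positivity)
  have h1 : (2 * (|β₁| + |β₂|)) * ∑ i, (v i : ℝ) ≤ (2 * (|β₁| + |β₂|)) * (c * N) :=
    mul_le_mul_of_nonneg_left hv (by positivity)
  have h2 := mul_le_mul_of_nonneg_left h1 (sq_nonneg u)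
  have h3 : ∫ β in β₁..β₂, ∫ x, gibbsAbsDev a b β x ∂gaussianPi v
      ≤ (u ^ 2 * (2 * (c * N) + 2 * (|β₁| + |β₂|) * (c * N)) + (u ^ 2)⁻¹ * (β₂ - β₁)) / 2 := by
    linarith
  have hNi : 0 ≤ N⁻¹ := by rw [hN', inv_inv]; positivity
  refine (mul_le_mul_of_nonneg_left h3 hNi).trans (le_of_eq ?_)
  rw [hN']
  field_simp

/-- The step δ = u = N^(-1/4) balances the self-averaging error δ⁻¹N^(1/2) against the convexity
error δN; each is of order u per site. -/
theorem integral_abs_gibbsEnergy_sub_div_le (ha : ∀ σ i, |a σ i| ≤ 1) {v : ι → ℝ≥0}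
    {N c u β₁ β₂ : ℝ} (hβ : β₁ ≤ β₂) (hu : 0 < u) (hu1 : u ≤ 1) (hN : N * u ^ 4 = 1)
    (hb : ∀ σ, |b σ| ≤ c * N) (hv : ∑ i, (v i : ℝ) ≤ c * N) :
    N⁻¹ * ∫ β in β₁..β₂, ∫ x, |gibbsEnergy a b β x - quenchedEnergy a b v β| ∂gaussianPi v
      ≤ ((β₂ - β₁) * (3 * (((|β₁| + |β₂| + 1) ^ 2 * c + 1) / 2))
        + 2 * (c + 2 * (|β₁| + |β₂| + 1) * c)) * u := by
  have hN' : N = (u ^ 4)⁻¹ := eq_inv_of_mul_eq_one_left hN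
  -- The summand 1 leaves room for the shifts by δ = u ≤ 1, so B does not depend on the volume.
  set B := |β₁| + |β₂| + 1 with hB
  have hB0 : 0 ≤ B := by positivity
  have h := integral_abs_gibbsEnergy_sub_le ha hb v (δ := u) (B := B) (t := u ^ 2) hβ hu
    (by linarith [abs_nonneg β₂]) (by linarith [abs_nonneg β₁]) (by positivity)
  have hβ' : 0 ≤ β₂ - β₁ := sub_nonneg.2 hβ
  have h3 : ∫ β in β₁..β₂, ∫ x, |gibbsEnergy a b β x - quenchedEnergy a b v β| ∂gaussianPi v
      ≤ u⁻¹ * ((β₂ - β₁) * (3 * ((u ^ 2 * (B ^ 2 * (c * N)) + (u ^ 2)⁻¹) / 2)))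
        + 2 * u * (c * N + 2 * B * (c * N)) := by
    refine h.trans ?_
    gcongr
  have hNi : 0 ≤ N⁻¹ := by rw [hN', inv_inv]; positivity
  refine (mul_le_mul_of_nonneg_left h3 hNi).trans (le_of_eq ?_)
  rw [hN']
  field_simp

end ThermodynamicBounds

/-! ### Volumes of boxes, spin products and the Gibbs state -/

theorem Box.one_le_vol {d : ℕ} (Λ : Box d) : 1 ≤ Λ.vol := by
  obtain ⟨a, b, hab, h⟩ := Λ.2
  have : Λ.1.Nonempty := h ▸ Finset.nonempty_Icc.2 hab
  exact Nat.one_le_cast.2 (Finset.card_pos.2 this)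

theorem Box.tendsto_vol {d : ℕ} (hd : 1 ≤ d) :
    Tendsto (fun Λ : Box d => Λ.vol) atTop atTop := by
  refine tendsto_atTop.2 fun C => ?_
  obtain ⟨n, hn⟩ := exists_nat_ge C
  have h0 : (0 : Site d) ≤ fun _ => (n : ℤ) := fun _ => Int.natCast_nonneg n
  let Λ₀ : Box d := ⟨Finset.Icc 0 (fun _ => (n : ℤ)), 0, _, h0, rfl⟩
  filter_upwards [eventually_ge_atTop Λ₀] with Λ hΛ
  have h1 : Λ₀.1.card ≤ Λ.1.card := Finset.card_le_card hΛ
  have h2 : Λ₀.1.card = (n + 1) ^ d := by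
    simp [Λ₀, Pi.card_Icc]
  -- This needs d ≥ 1: in dimension 0 every box has one site.
  have h3 : n + 1 ≤ (n + 1) ^ d := Nat.le_self_pow (by omega) _
  have h4 : n ≤ Λ.1.card := by omega
  have h5 : (n : ℝ) ≤ Λ.vol := Nat.cast_le.2 h4
  linarith

theorem spinProd_sq {d : ℕ} {Λ : Box d} (σ : Config Λ) (X : Finset (Site d)) :
    spinProd σ X * spinProd σ X = 1 := by
  unfold spinProd
  rw [← Finset.prod_mul_distrib]
  refine Finset.prod_eq_one fun i _ => ?_
  rcases Int.units_eq_one_or (σ i) with h | h <;> simp [h]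

theorem abs_spinProd {d : ℕ} {Λ : Box d} (σ : Config Λ) (X : Finset (Site d)) :
    |spinProd σ X| = 1 := by
  have h := spinProd_sq σ X
  rw [← abs_mul_abs_self] at h
  have h0 := abs_nonneg (spinProd σ X)
  nlinarith

/-- The spin products `σ_X` as coefficients of the couplings. -/
def spinCoeff {d : ℕ} {Λ : Box d} (σ : Config Λ) (X : {X // X ∈ interactionSets Λ}) : ℝ :=
  spinProd σ X.1

theorem gibbs_eq_replicaAvg {d : ℕ} {Λ : Box d} (n : ℕ) (H : Config Λ → ℝ) (β : ℝ)
    (O : (Fin n → Config Λ) → ℝ) : gibbs n H β O = replicaAvg (fun σ => -β * H σ) O := by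
  unfold gibbs replicaAvg
  refine Finset.sum_congr rfl fun s _ => ?_
  simp only [softmax, Finset.prod_div_distrib, Finset.prod_const, Finset.card_univ,
    Fintype.card_fin, partitionFn, Finset.mul_sum, Real.exp_sum]

theorem sum_sum_ite_ne {R : ℕ} (F : Fin R → Fin R → ℝ) :
    (∑ k, ∑ l, if k ≠ l then F k l else 0) = ∑ k, ∑ l, F k l - ∑ k, F k k := by
  rw [← Finset.sum_sub_distrib]
  refine Finset.sum_congr rfl fun k _ => ?_
  have h : ∀ l, (if k ≠ l then F k l else 0) = F k l - if k = l then F k l else 0 := fun l => by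
    by_cases hkl : k = l <;> simp [hkl]
  simp only [h, Finset.sum_sub_distrib]
  simp

/-! ### The spin glass as an affine Gaussian model -/

namespace Model

variable {d : ℕ} {Ω : Type*} [MeasurableSpace Ω] {P : Measure Ω}

/-- The variances of the couplings in the box `Λ`. -/
def couplingVar (M : Model d P) (Λ : Box d) (X : {X // X ∈ interactionSets Λ}) : ℝ≥0 :=
  M.Δ Λ X.1 ^ 2

/-- The centered couplings in the box `Λ`. -/
def centered (M : Model d P) (Λ : Box d) (w : Ω) (X : {X // X ∈ interactionSets Λ}) : ℝ :=
  M.J' Λ X.1 w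

/-- Independence and the marginal laws determine the joint law, so averages over the couplings
become integrals against `gaussianPi`. -/
theorem hasLaw_centered [IsProbabilityMeasure P] (M : Model d P) (Λ : Box d) :
    HasLaw (M.centered Λ) (gaussianPi (M.couplingVar Λ)) P where
  aemeasurable := aemeasurable_pi_lambda _ fun X => (M.law Λ X.1 X.2).aemeasurable
  map_eq := by
    have h := (iIndepFun_iff_map_fun_eq_pi_map
      fun X : {X // X ∈ interactionSets Λ} => (M.law Λ X.1 X.2).aemeasurable).1 (M.indep Λ)
    simp only [(M.law Λ _ (Subtype.property _)).map_eq] at h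
    exact h

theorem hamiltonian_eq_sub (M : Model d P) (μ : ℝ) (Λ : Box d) (w : Ω) (σ : Config Λ) :
    M.hamiltonian μ Λ w σ = -(∑ X ∈ interactionSets Λ, μ * M.μ' Λ X * spinProd σ X)
      - ∑ X, M.centered Λ w X * spinCoeff σ X := by
  have h : ∑ X, M.centered Λ w X * spinCoeff σ X
      = ∑ X ∈ interactionSets Λ, M.J' Λ X w * spinProd σ X :=
    Finset.sum_coe_sort (interactionSets Λ) fun X => M.J' Λ X w * spinProd σ X
  rw [h]
  simp only [hamiltonian, coupling, add_mul, Finset.sum_add_distrib]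
  ring

theorem memLp_centered [IsProbabilityMeasure P] (M : Model d P) (Λ : Box d)
    (X : {X // X ∈ interactionSets Λ}) : MemLp (fun w => M.centered Λ w X) 2 P := by
  have h := M.law Λ X.1 X.2
  have h2 : MemLp id 2 (P.map (M.J' Λ X.1)) := by
    rw [h.map_eq]; exact memLp_id_gaussianReal 2
  exact (memLp_map_measure_iff aestronglyMeasurable_id h.aemeasurable).1 h2

theorem integral_centered [IsProbabilityMeasure P] (M : Model d P) (Λ : Box d)
    (X : {X // X ∈ interactionSets Λ}) : ∫ w, M.centered Λ w X ∂P = 0 := by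
  have h := (M.law Λ X.1 X.2).integral_comp (f := fun x => x) (by fun_prop)
  rw [integral_id_gaussianReal] at h
  exact h

theorem integral_centered_mul [IsProbabilityMeasure P] (M : Model d P) (Λ : Box d)
    (X Y : {X // X ∈ interactionSets Λ}) :
    ∫ w, M.centered Λ w X * M.centered Λ w Y ∂P
      = if X = Y then (M.couplingVar Λ X : ℝ) else 0 := by
  split_ifs with hXY
  · subst hXY
    have h := (M.law Λ X.1 X.2).integral_comp (f := fun x => x * x) (by fun_prop)
    have hv := variance_fun_id_gaussianReal (μ := 0) (v := M.Δ Λ X.1 ^ 2)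
    rw [variance_of_integral_eq_zero (by fun_prop) (by simp [integral_id_gaussianReal])] at hv
    simp only [pow_two] at hv h
    exact h.trans (by simpa [pow_two, couplingVar] using hv)
  · have h := ((M.indep Λ).indepFun hXY).integral_fun_mul_eq_mul_integral
      (M.memLp_centered Λ X).aestronglyMeasurable (M.memLp_centered Λ Y).aestronglyMeasurable
    refine h.trans ?_
    have h0 := M.integral_centered Λ X
    simp only [centered] at h0
    rw [h0, zero_mul]

theorem meanH_eq [IsProbabilityMeasure P] (M : Model d P) (μ : ℝ) (Λ : Box d) (σ : Config Λ) :
    M.meanH μ Λ σ = -∑ X ∈ interactionSets Λ, μ * M.μ' Λ X * spinProd σ X := by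
  have hi : ∀ X, Integrable (fun w => M.centered Λ w X * spinCoeff σ X) P := fun X =>
    ((M.memLp_centered Λ X).integrable one_le_two).mul_const _
  unfold meanH
  simp only [hamiltonian_eq_sub]
  rw [integral_sub (integrable_const _) (integrable_finsetSum _ fun X _ => hi X),
    integral_finsetSum _ fun X _ => hi X]
  simp only [integral_mul_const, integral_centered]
  simp

theorem hamiltonian_eq_energy [IsProbabilityMeasure P] (M : Model d P) (μ : ℝ) (Λ : Box d)
    (w : Ω) : M.hamiltonian μ Λ w = energy spinCoeff (M.meanH μ Λ) (M.centered Λ w) := by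
  ext σ
  rw [hamiltonian_eq_sub, energy, meanH_eq]

/-- In the expanded product only the diagonal pairs survive, since distinct couplings are
independent and centred. -/
theorem covH_eq [IsProbabilityMeasure P] (M : Model d P) (μ : ℝ) (Λ : Box d) (σ τ : Config Λ) :
    M.covH μ Λ σ τ = energyCov spinCoeff (M.couplingVar Λ) σ τ := by
  have h : ∀ w, (M.hamiltonian μ Λ w σ - M.meanH μ Λ σ) * (M.hamiltonian μ Λ w τ - M.meanH μ Λ τ)
      = ∑ X, ∑ Y, spinCoeff σ X * spinCoeff τ Y * (M.centered Λ w X * M.centered Λ w Y) := by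
    intro w
    simp only [hamiltonian_eq_energy, energy, sub_sub_cancel_left, neg_mul_neg]
    rw [Finset.sum_mul_sum]
    exact Finset.sum_congr rfl fun X _ => Finset.sum_congr rfl fun Y _ => by ring
  have hi : ∀ X Y, Integrable (fun w => spinCoeff σ X * spinCoeff τ Y
      * (M.centered Λ w X * M.centered Λ w Y)) P := fun X Y =>
    ((M.memLp_centered Λ X).integrable_mul (M.memLp_centered Λ Y)).const_mul _
  unfold covH
  simp only [h]
  rw [integral_finsetSum _ fun X _ => integrable_finsetSum _ fun Y _ => hi X Y]
  refine Finset.sum_congr rfl fun X _ => ?_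
  rw [integral_finsetSum _ fun Y _ => hi X Y]
  simp only [integral_const_mul, integral_centered_mul]
  simp
  ring

theorem quenched_eq [IsProbabilityMeasure P] (M : Model d P) (β μ : ℝ) (Λ : Box d) {n : ℕ}
    (O : (Fin n → Config Λ) → ℝ) :
    M.quenched β μ Λ O
      = quenchedAvg spinCoeff (M.meanH μ Λ) (M.couplingVar Λ) β O := by
  have h := (M.hasLaw_centered Λ).integral_comp
    (f := fun x => replicaAvg (logBoltzmann spinCoeff (M.meanH μ Λ) β x) O)
    (integrable_replicaAvg (M.couplingVar Λ) β O).aestronglyMeasurable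
  unfold quenched quenchedAvg
  rw [← h]
  congr 1; ext w
  rw [gibbs_eq_replicaAvg, hamiltonian_eq_energy]
  rfl

theorem abs_spinCoeff_le {Λ : Box d} (σ : Config Λ) (X : {X // X ∈ interactionSets Λ}) :
    |spinCoeff σ X| ≤ 1 := (abs_spinProd σ X.1).le

/-- As σ_X² = 1, the self-overlap is the same constant for every configuration. This is what removes
the diagonal terms from f₁. -/
theorem energyCov_self (M : Model d P) (Λ : Box d) (σ : Config Λ) :
    energyCov spinCoeff (M.couplingVar Λ) σ σ = ∑ X, (M.couplingVar Λ X : ℝ) :=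
  Finset.sum_congr rfl fun X _ => by rw [mul_assoc, spinCoeff, spinProd_sq, mul_one]

theorem sum_couplingVar_le (M : Model d P) {Λ : Box d} {c : ℝ}
    (h : 1 / Λ.vol * ∑ X ∈ interactionSets Λ, (M.Δ Λ X : ℝ) ^ 2 ≤ c) :
    ∑ X, (M.couplingVar Λ X : ℝ) ≤ c * Λ.vol := by
  have h1 : ∑ X, (M.couplingVar Λ X : ℝ) = ∑ X ∈ interactionSets Λ, (M.Δ Λ X : ℝ) ^ 2 := by
    simp only [couplingVar, NNReal.coe_pow]
    exact Finset.sum_coe_sort (interactionSets Λ) fun X => (M.Δ Λ X : ℝ) ^ 2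
  have hN : 0 < Λ.vol := zero_lt_one.trans_le Λ.one_le_vol
  rw [h1]
  rwa [one_div, inv_mul_le_iff₀ hN, mul_comm] at h

theorem abs_meanH_le [IsProbabilityMeasure P] (M : Model d P) {μ : ℝ} {Λ : Box d} {c : ℝ}
    (h : 1 / Λ.vol * ∑ X ∈ interactionSets Λ, |μ * M.μ' Λ X| ≤ c) (σ : Config Λ) :
    |M.meanH μ Λ σ| ≤ c * Λ.vol := by
  have hN : 0 < Λ.vol := zero_lt_one.trans_le Λ.one_le_vol
  rw [one_div, inv_mul_le_iff₀ hN, mul_comm] at h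
  rw [meanH_eq, abs_neg]
  refine (Finset.abs_sum_le_sum_abs _ _).trans (le_trans (le_of_eq ?_) h)
  exact Finset.sum_congr rfl fun X _ => by rw [abs_mul, abs_spinProd, mul_one]

theorem abs_covH_le [IsProbabilityMeasure P] (M : Model d P) {μ : ℝ} {Λ : Box d} {c : ℝ}
    (h : 1 / Λ.vol * ∑ X ∈ interactionSets Λ, (M.Δ Λ X : ℝ) ^ 2 ≤ c) (σ τ : Config Λ) :
    |M.covH μ Λ σ τ| ≤ c * Λ.vol := by
  rw [covH_eq]
  exact (abs_energyCov_le abs_spinCoeff_le _ σ τ).trans (M.sum_couplingVar_le h)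

/-- Thermodynamic stability bounds the observables uniformly in the volume. -/
theorem exists_abs_observable_le [IsProbabilityMeasure P] (M : Model d P) {μ : ℝ}
    (hM : M.ThermodynamicallyStable μ) {R : ℕ} {G : (Fin R → ℝ) × (Fin R → Fin R → ℝ) → ℝ}
    (hG : Continuous G) : ∃ C, 0 ≤ C ∧ ∀ Λ σ, |M.observable μ Λ G σ| ≤ C := by
  obtain ⟨c, hc⟩ := hM
  -- By stability all magnetizations and overlaps lie in the sup-norm ball of radius c, for every
  -- box; a continuous G is bounded there.
  obtain ⟨C, hC⟩ := (isCompact_closedBall (0 : (Fin R → ℝ) × (Fin R → Fin R → ℝ))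
    c).exists_bound_of_continuousOn hG.continuousOn
  refine ⟨max C 0, le_max_right _ _, fun Λ σ => le_max_of_le_left (hC _ ?_)⟩
  have hN : 0 < Λ.vol := zero_lt_one.trans_le Λ.one_le_vol
  have hc0 : 0 ≤ c := le_trans (mul_nonneg (by positivity)
    (Finset.sum_nonneg fun _ _ => abs_nonneg _)) (hc Λ).1
  have hdiv : ∀ z : ℝ, |z| ≤ c * Λ.vol → ‖1 / Λ.vol * z‖ ≤ c := by
    intro z hz
    rw [Real.norm_eq_abs, abs_mul, abs_of_pos (by positivity : 0 < 1 / Λ.vol), one_div,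
      inv_mul_le_iff₀ hN, mul_comm]
    exact hz
  rw [mem_closedBall_zero_iff, Prod.norm_def]
  refine max_le ((pi_norm_le_iff_of_nonneg hc0).2 fun k => hdiv _ (M.abs_meanH_le (hc Λ).1 _))
    ((pi_norm_le_iff_of_nonneg hc0).2 fun k => (pi_norm_le_iff_of_nonneg hc0).2 fun l =>
      hdiv _ (M.abs_covH_le (hc Λ).2 _ _))

variable {R : ℕ}

theorem exists_observable_eq (M : Model d P) (μ : ℝ) (Λ : Box d)
    (G : (Fin R → ℝ) × (Fin R → Fin R → ℝ) → ℝ) : ∃ g : (Fin R → Config Λ) → ℝ,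
      ∀ s, M.observable μ Λ G s = g (fun k => s (Fin.castAdd 2 k)) :=
  ⟨fun u => G (fun k => 1 / Λ.vol * M.meanH μ Λ (u k),
    fun k l => 1 / Λ.vol * M.covH μ Λ (u k) (u l)), fun _ => rfl⟩

/-- `f₁` compares the energies of the replicas. -/
theorem f₁_eq [IsProbabilityMeasure P] (M : Model d P)
    (G : (Fin R → ℝ) × (Fin R → Fin R → ℝ) → ℝ) (Λ : Box d) (β μ : ℝ) :
    M.f₁ G Λ β μ = (Λ.vol)⁻¹ * ∑ l : Fin R,
      (energyAvg spinCoeff (M.meanH μ Λ) (M.couplingVar Λ) β (Fin.castAdd 2 l)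
          (M.observable μ Λ G)
        - energyAvg spinCoeff (M.meanH μ Λ) (M.couplingVar Λ) β (Fin.natAdd R (0 : Fin 2))
          (M.observable μ Λ G)) := by
  set O := M.observable μ Λ G with hO
  set v := M.couplingVar Λ with hv
  set b := M.meanH μ Λ with hb
  set N := Λ.vol with hN
  have hcov : ∀ σ τ, M.covH μ Λ σ τ = energyCov spinCoeff v σ τ := M.covH_eq μ Λ
  obtain ⟨g, hOg⟩ := M.exists_observable_eq μ Λ G
  have h1 := energyAvg_castAdd (b := b) abs_spinCoeff_le v β g hOg
  have h2 := energyAvg_natAdd (b := b) abs_spinCoeff_le v β g hOg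
  rw [← hO] at h1 h2
  simp only [h1, h2]
  have hmag : ∀ (l : Fin R), M.quenched β μ Λ (fun σ => (M.mag μ Λ (Fin.castAdd 2 l) σ
      - M.mag μ Λ (Fin.natAdd R (0 : Fin 2)) σ) * O σ)
      = N⁻¹ * (quenchedAvg spinCoeff b v β (fun s => b (s (Fin.castAdd 2 l)) * O s)
        - quenchedAvg spinCoeff b v β (fun s => b (s (Fin.natAdd R (0 : Fin 2))) * O s)) := by
    intro l
    rw [quenched_eq, ← quenchedAvg_sub, ← quenchedAvg_const_mul]
    congr 1; ext s
    simp only [mag]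
    ring
  -- The R self-overlaps of the replicas l ≤ R cancel against the R copies of the self-overlap of
  -- replica R + 1, which is why only k ≠ l occurs in f₁.
  have hdiag : ∀ r : Fin (R + 2), quenchedAvg spinCoeff b v β
      (fun s : Fin (R + 2) → Config Λ => energyCov spinCoeff v (s r) (s r) * O s)
      = (∑ X, (v X : ℝ)) * quenchedAvg spinCoeff b v β O := by
    intro r
    simp only [hv, energyCov_self, quenchedAvg_const_mul]
  have hover : M.quenched β μ Λ (fun σ =>
        (∑ k : Fin R, ∑ l : Fin R, if k ≠ l then O σ
          * M.overlap μ Λ (Fin.castAdd 2 l) (Fin.castAdd 2 k) σ else 0)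
          - 2 * (R : ℝ) * O σ * ∑ l : Fin R, M.overlap μ Λ (Fin.castAdd 2 l)
            (Fin.natAdd R (0 : Fin 2)) σ
          + (R : ℝ) * ((R : ℝ) + 1) * O σ * M.overlap μ Λ (Fin.natAdd R (0 : Fin 2))
            (Fin.natAdd R (1 : Fin 2)) σ)
      = N⁻¹ * ((∑ l : Fin R, ∑ k : Fin R, quenchedAvg spinCoeff b v β
            (fun s : Fin (R + 2) → Config Λ =>
              energyCov spinCoeff v (s (Fin.castAdd 2 l)) (s (Fin.castAdd 2 k)) * O s))
          - R * ((∑ X, (v X : ℝ)) * quenchedAvg spinCoeff b v β O)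
          - 2 * R * (∑ l : Fin R, quenchedAvg spinCoeff b v β (fun s => energyCov spinCoeff v
            (s (Fin.castAdd 2 l)) (s (Fin.natAdd R (0 : Fin 2))) * O s))
          + R * (R + 1) * quenchedAvg spinCoeff b v β (fun s => energyCov spinCoeff v
            (s (Fin.natAdd R (0 : Fin 2))) (s (Fin.natAdd R (1 : Fin 2))) * O s)) := by
    rw [quenched_eq]
    simp only [← quenchedAvg_sum, ← quenchedAvg_const_mul, ← quenchedAvg_sub, ← quenchedAvg_add]
    congr 1; ext s
    simp only [overlap, hcov]
    have e1 : ∑ k : Fin R, ∑ l : Fin R, O s * (1 / N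
        * energyCov spinCoeff v (s (Fin.castAdd 2 l)) (s (Fin.castAdd 2 k)))
        = N⁻¹ * ∑ l : Fin R, ∑ k : Fin R,
          energyCov spinCoeff v (s (Fin.castAdd 2 l)) (s (Fin.castAdd 2 k)) * O s := by
      rw [Finset.sum_comm]
      simp only [Finset.mul_sum]
      exact Finset.sum_congr rfl fun l _ => Finset.sum_congr rfl fun k _ => by ring
    have e2 : ∑ k : Fin R, O s * (1 / N
        * energyCov spinCoeff v (s (Fin.castAdd 2 k)) (s (Fin.castAdd 2 k)))
        = N⁻¹ * (R * ((∑ X, (v X : ℝ)) * O s)) := by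
      simp only [hv, energyCov_self, Finset.sum_const, Finset.card_univ, Fintype.card_fin,
        nsmul_eq_mul]
      ring
    have e3 : ∑ l : Fin R, 1 / N
        * energyCov spinCoeff v (s (Fin.castAdd 2 l)) (s (Fin.natAdd R (0 : Fin 2)))
        = N⁻¹ * ∑ l : Fin R,
          energyCov spinCoeff v (s (Fin.castAdd 2 l)) (s (Fin.natAdd R (0 : Fin 2))) := by
      rw [Finset.mul_sum, one_div]
    rw [sum_sum_ite_ne fun k l => O s * (1 / N
      * energyCov spinCoeff v (s (Fin.castAdd 2 l)) (s (Fin.castAdd 2 k))), e1, e2, e3,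
      ← Finset.sum_mul Finset.univ (fun l : Fin R =>
        energyCov spinCoeff v (s (Fin.castAdd 2 l)) (s (Fin.natAdd R (0 : Fin 2))))]
    ring
  have hf : M.f₁ G Λ β μ = (∑ l : Fin R, M.quenched β μ Λ (fun σ =>
      (M.mag μ Λ (Fin.castAdd 2 l) σ - M.mag μ Λ (Fin.natAdd R (0 : Fin 2)) σ) * O σ))
      - β * M.quenched β μ Λ (fun σ =>
        (∑ k : Fin R, ∑ l : Fin R, if k ≠ l then O σ
          * M.overlap μ Λ (Fin.castAdd 2 l) (Fin.castAdd 2 k) σ else 0)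
          - 2 * (R : ℝ) * O σ * ∑ l : Fin R, M.overlap μ Λ (Fin.castAdd 2 l)
            (Fin.natAdd R (0 : Fin 2)) σ
          + (R : ℝ) * ((R : ℝ) + 1) * O σ * M.overlap μ Λ (Fin.natAdd R (0 : Fin 2))
            (Fin.natAdd R (1 : Fin 2)) σ) := rfl
  rw [hf, hover]
  simp only [hmag, Fin.sum_univ_castSucc]
  have hlast : (Fin.last R).castSucc = Fin.natAdd R (0 : Fin 2) := rfl
  have hcast : ∀ k : Fin R, k.castSucc.castSucc = Fin.castAdd 2 k := fun k => rfl
  simp only [hlast, hcast, hdiag]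
  -- Symmetry identifies the overlaps of l with R + 1 arising from both energies; each contributes R
  -- times, giving the coefficient 2R.
  simp only [energyCov_comm v (_ : Config Λ) _]
  simp only [Finset.sum_sub_distrib, Finset.sum_const, Finset.card_univ, Fintype.card_fin,
    nsmul_eq_mul, ← Finset.mul_sum]
  ring

/-- `f₂` compares the energy of a replica with its mean. -/
theorem f₂_eq [IsProbabilityMeasure P] (M : Model d P)
    (G : (Fin R → ℝ) × (Fin R → Fin R → ℝ) → ℝ) (Λ : Box d) (β μ : ℝ) :
    M.f₂ G Λ β μ = (Λ.vol)⁻¹ *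
      (energyAvg spinCoeff (M.meanH μ Λ) (M.couplingVar Λ) β (Fin.natAdd R (0 : Fin 2))
          (M.observable μ Λ G)
        - quenchedEnergy spinCoeff (M.meanH μ Λ) (M.couplingVar Λ) β
          * quenchedAvg spinCoeff (M.meanH μ Λ) (M.couplingVar Λ) β (M.observable μ Λ G)) := by
  set O := M.observable μ Λ G with hO
  set v := M.couplingVar Λ with hv
  set b := M.meanH μ Λ with hb
  set N := Λ.vol with hN
  have hcov : ∀ σ τ, M.covH μ Λ σ τ = energyCov spinCoeff v σ τ := M.covH_eq μ Λ
  obtain ⟨g, hOg⟩ := M.exists_observable_eq μ Λ G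
  have h2 := energyAvg_natAdd (b := b) abs_spinCoeff_le v β g hOg
  -- The replicas 0 and 1 exist and differ even for R = 0, because the family has R + 2 members.
  have h3 := quenchedEnergy_eq (b := b) abs_spinCoeff_le v β
    (k := (0 : Fin (R + 2))) (l := 1) (by simp)
  rw [← hO] at h2
  rw [h2, h3]
  have q1 : M.quenched β μ Λ (fun σ => M.mag μ Λ (Fin.natAdd R (0 : Fin 2)) σ * O σ)
      = N⁻¹ * quenchedAvg spinCoeff b v β (fun s => b (s (Fin.natAdd R (0 : Fin 2))) * O s) := by
    rw [quenched_eq, ← quenchedAvg_const_mul]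
    congr 1; ext s
    simp only [mag]
    ring
  have q2 : M.quenched β μ Λ (M.mag μ Λ (0 : Fin (R + 2)))
      = N⁻¹ * quenchedAvg spinCoeff b v β (fun s : Fin (R + 2) → Config Λ => b (s 0)) := by
    rw [quenched_eq, ← quenchedAvg_const_mul]
    congr 1; ext s
    simp only [mag]
    ring
  have q3 : ∀ k l : Fin (R + 2), M.quenched β μ Λ (fun σ => O σ * M.overlap μ Λ k l σ)
      = N⁻¹ * quenchedAvg spinCoeff b v β
        (fun s : Fin (R + 2) → Config Λ => energyCov spinCoeff v (s l) (s k) * O s) := by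
    intro k l
    rw [quenched_eq, ← quenchedAvg_const_mul]
    congr 1; ext s
    simp only [overlap, hcov, energyCov_comm v (s l) (s k)]
    ring
  have q4 : ∀ k l : Fin (R + 2), M.quenched β μ Λ (M.overlap μ Λ k l)
      = N⁻¹ * quenchedAvg spinCoeff b v β
        (fun s : Fin (R + 2) → Config Λ => energyCov spinCoeff v (s k) (s l)) := by
    intro k l
    rw [quenched_eq, ← quenchedAvg_const_mul]
    congr 1; ext s
    simp only [overlap, hcov]
    ring
  have hf : M.f₂ G Λ β μ = M.quenched β μ Λ
        (fun σ => M.mag μ Λ (Fin.natAdd R (0 : Fin 2)) σ * O σ)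
      - M.quenched β μ Λ (M.mag μ Λ (0 : Fin (R + 2))) * M.quenched β μ Λ O
      - β * ((∑ k : Fin (R + 1), M.quenched β μ Λ (fun σ => O σ
            * M.overlap μ Λ k.castSucc (Fin.natAdd R (0 : Fin 2)) σ))
        - ((R : ℝ) + 1) * M.quenched β μ Λ (fun σ => O σ
            * M.overlap μ Λ (Fin.natAdd R (0 : Fin 2)) (Fin.natAdd R (1 : Fin 2)) σ)
        - M.quenched β μ Λ O * (M.quenched β μ Λ (M.overlap μ Λ (0 : Fin (R + 2)) 0)
          - M.quenched β μ Λ (M.overlap μ Λ (0 : Fin (R + 2)) 1))) := rfl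
  have q5 : ∀ s : Fin (R + 2) → Config Λ, energyCov spinCoeff v
      (s (Fin.natAdd R (1 : Fin 2))) (s (Fin.natAdd R (0 : Fin 2))) * O s
      = energyCov spinCoeff v
      (s (Fin.natAdd R (0 : Fin 2))) (s (Fin.natAdd R (1 : Fin 2))) * O s := fun s => by
    rw [energyCov_comm]
  rw [hf, q1, q2, q4, q4]
  simp only [q3, q5]
  rw [← Finset.mul_sum, quenched_eq]
  ring

end Model

/-! ### Continuity in β and fluctuation bounds for f₁ and f₂ -/

namespace Model

variable {d : ℕ} {Ω : Type*} [MeasurableSpace Ω] {P : Measure Ω} {R : ℕ}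

theorem continuous_f₁ [IsProbabilityMeasure P] (M : Model d P)
    (G : (Fin R → ℝ) × (Fin R → Fin R → ℝ) → ℝ) (Λ : Box d) (μ : ℝ) :
    Continuous fun β => M.f₁ G Λ β μ := by
  have hq : ∀ {n : ℕ} (O : (Fin n → Config Λ) → ℝ),
      Continuous fun β => M.quenched β μ Λ O := fun O => by
    simp only [quenched_eq]; exact continuous_quenchedAvg _ _
  exact (continuous_finsetSum _ fun l _ => hq _).sub (continuous_id.mul (hq _))

theorem continuous_f₂ [IsProbabilityMeasure P] (M : Model d P)
    (G : (Fin R → ℝ) × (Fin R → Fin R → ℝ) → ℝ) (Λ : Box d) (μ : ℝ) :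
    Continuous fun β => M.f₂ G Λ β μ := by
  have hq : ∀ {n : ℕ} (O : (Fin n → Config Λ) → ℝ),
      Continuous fun β => M.quenched β μ Λ O := fun O => by
    simp only [quenched_eq]; exact continuous_quenchedAvg _ _
  exact ((hq _).sub ((hq _).mul (hq _))).sub (continuous_id.mul
    (((continuous_finsetSum _ fun k _ => hq _).sub (continuous_const.mul (hq _))).sub
      ((hq _).mul ((hq _).sub (hq _)))))

theorem abs_f₁_le [IsProbabilityMeasure P] (M : Model d P)
    {G : (Fin R → ℝ) × (Fin R → Fin R → ℝ) → ℝ} {Λ : Box d} {μ A C : ℝ} (β : ℝ)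
    (hA : ∀ σ, |M.meanH μ Λ σ| ≤ A) (hC : ∀ σ, |M.observable μ Λ G σ| ≤ C) :
    |M.f₁ G Λ β μ| ≤ (Λ.vol)⁻¹ * (R * (2 * C) *
      ∫ x, gibbsAbsDev spinCoeff (M.meanH μ Λ) β x ∂gaussianPi (M.couplingVar Λ)) := by
  have hN : 0 ≤ (Λ.vol)⁻¹ := inv_nonneg.2 (zero_le_one.trans Λ.one_le_vol)
  rw [f₁_eq, abs_mul, abs_of_nonneg hN]
  refine mul_le_mul_of_nonneg_left ?_ hN
  refine (Finset.abs_sum_le_sum_abs _ _).trans ((Finset.sum_le_sum fun l _ =>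
    abs_energyAvg_sub_le abs_spinCoeff_le hA (M.couplingVar Λ) β _ _ hC).trans (le_of_eq ?_))
  rw [Finset.sum_const, Finset.card_univ, Fintype.card_fin, nsmul_eq_mul, ← mul_assoc]

theorem abs_f₂_le [IsProbabilityMeasure P] (M : Model d P)
    {G : (Fin R → ℝ) × (Fin R → Fin R → ℝ) → ℝ} {Λ : Box d} {μ A C : ℝ} (β : ℝ)
    (hA : ∀ σ, |M.meanH μ Λ σ| ≤ A) (hC : ∀ σ, |M.observable μ Λ G σ| ≤ C) :
    |M.f₂ G Λ β μ| ≤ (Λ.vol)⁻¹ * (C *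
      (∫ x, gibbsAbsDev spinCoeff (M.meanH μ Λ) β x ∂gaussianPi (M.couplingVar Λ)
        + ∫ x, |gibbsEnergy spinCoeff (M.meanH μ Λ) β x
          - quenchedEnergy spinCoeff (M.meanH μ Λ) (M.couplingVar Λ) β|
          ∂gaussianPi (M.couplingVar Λ))) := by
  have hN : 0 ≤ (Λ.vol)⁻¹ := inv_nonneg.2 (zero_le_one.trans Λ.one_le_vol)
  rw [f₂_eq, abs_mul, abs_of_nonneg hN]
  exact mul_le_mul_of_nonneg_left
    (abs_energyAvg_sub_mul_le abs_spinCoeff_le hA (M.couplingVar Λ) β _ hC) hN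

end Model

/-! ### The scale of the fluctuations and the infinite-volume limit -/

/-- The inverse fourth root of the volume. -/
def Box.scale {d : ℕ} (Λ : Box d) : ℝ := (√(√Λ.vol))⁻¹

theorem Box.scale_pos {d : ℕ} (Λ : Box d) : 0 < Λ.scale :=
  inv_pos.2 (Real.sqrt_pos.2 (Real.sqrt_pos.2 (zero_lt_one.trans_le Λ.one_le_vol)))

theorem Box.scale_le_one {d : ℕ} (Λ : Box d) : Λ.scale ≤ 1 :=
  inv_le_one_of_one_le₀ (Real.one_le_sqrt.2 (Real.one_le_sqrt.2 Λ.one_le_vol))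

theorem Box.vol_mul_scale_pow {d : ℕ} (Λ : Box d) : Λ.vol * Λ.scale ^ 4 = 1 := by
  have hN : 0 < Λ.vol := zero_lt_one.trans_le Λ.one_le_vol
  have h : √(√Λ.vol) ^ 4 = Λ.vol := by
    rw [show 4 = 2 * 2 from rfl, pow_mul, Real.sq_sqrt (Real.sqrt_nonneg _), Real.sq_sqrt hN.le]
  rw [scale, inv_pow, h, mul_inv_cancel₀ hN.ne']

theorem Box.tendsto_scale {d : ℕ} (hd : 1 ≤ d) :
    Tendsto (fun Λ : Box d => Λ.scale) atTop (𝓝 0) :=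
  tendsto_inv_atTop_zero.comp
    (Real.tendsto_sqrt_atTop.comp (Real.tendsto_sqrt_atTop.comp (Box.tendsto_vol hd)))

end SpinGlass

end

theorem theorem1 {d : ℕ} (hd : 1 ≤ d) {Ω : Type*} [MeasurableSpace Ω] (P : Measure Ω)
    [IsProbabilityMeasure P] (M : SpinGlass.Model d P) (μ : ℝ)
    (hM : M.ThermodynamicallyStable μ)
    (R : ℕ) (G : (Fin R → ℝ) × (Fin R → Fin R → ℝ) → ℝ) (hG : ContDiff ℝ ∞ G)
    (β₁ β₂ : ℝ) (hβ : β₁ ≤ β₂) :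
    (∀ Λ : SpinGlass.Box d,
      IntervalIntegrable (fun β => M.f₁ G Λ β μ) volume β₁ β₂ ∧
      IntervalIntegrable (fun β => M.f₂ G Λ β μ) volume β₁ β₂) ∧
    Tendsto (fun Λ : SpinGlass.Box d => ∫ β in β₁..β₂, |M.f₁ G Λ β μ|) atTop (𝓝 0) ∧
    Tendsto (fun Λ : SpinGlass.Box d => ∫ β in β₁..β₂, |M.f₂ G Λ β μ|) atTop (𝓝 0) := by
  open SpinGlass in
  obtain ⟨C, hC0, hC⟩ := M.exists_abs_observable_le hM hG.continuous
  obtain ⟨c, hc⟩ := hM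
  have hb : ∀ Λ σ, |M.meanH μ Λ σ| ≤ c * Λ.vol := fun Λ σ => M.abs_meanH_le (hc Λ).1 σ
  have hv : ∀ Λ, ∑ X, (M.couplingVar Λ X : ℝ) ≤ c * Λ.vol := fun Λ =>
    M.sum_couplingVar_le (hc Λ).2
  have hDc := fun Λ => continuous_integral_gibbsAbsDev (Model.abs_spinCoeff_le (Λ := Λ)) (hb Λ)
    (M.couplingVar Λ)
  have hTc := fun Λ => continuous_integral_abs_gibbsEnergy_sub
    (Model.abs_spinCoeff_le (Λ := Λ)) (hb Λ) (M.couplingVar Λ)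
  -- The constants for thermal and for disorder fluctuations depend on c, β₁ and β₂ only, not on the
  -- box.
  set KD := (2 * c + 2 * (|β₁| + |β₂|) * c + (β₂ - β₁)) / 2 with hKD
  set KT := (β₂ - β₁) * (3 * (((|β₁| + |β₂| + 1) ^ 2 * c + 1) / 2))
        + 2 * (c + 2 * (|β₁| + |β₂| + 1) * c) with hKT
  have hD := fun Λ => integral_gibbsAbsDev_div_le (Model.abs_spinCoeff_le (Λ := Λ)) hβ
    Λ.scale_pos Λ.vol_mul_scale_pow (hb Λ) (hv Λ)
  have hT := fun Λ => integral_abs_gibbsEnergy_sub_div_le (Model.abs_spinCoeff_le (Λ := Λ)) hβ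
    Λ.scale_pos Λ.scale_le_one Λ.vol_mul_scale_pow (hb Λ) (hv Λ)
  have hs := Box.tendsto_scale hd
  refine ⟨fun Λ => ⟨(M.continuous_f₁ G Λ μ).intervalIntegrable _ _,
    (M.continuous_f₂ G Λ μ).intervalIntegrable _ _⟩, ?_, ?_⟩
  · have hlim : Tendsto (fun Λ : Box d => R * (2 * C) * (KD * Λ.scale ^ 2)) atTop (𝓝 0) := by
      simpa using ((hs.pow 2).const_mul KD).const_mul (R * (2 * C))
    refine squeeze_zero (fun Λ => intervalIntegral.integral_nonneg hβ fun _ _ => abs_nonneg _)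
      (fun Λ => ?_) hlim
    have hmono := intervalIntegral.integral_mono_on (μ := volume) hβ
      ((M.continuous_f₁ G Λ μ).abs.intervalIntegrable _ _)
      ((((hDc Λ).const_mul (R * (2 * C))).const_mul (Λ.vol)⁻¹).intervalIntegrable _ _)
      fun β _ => M.abs_f₁_le β (hb Λ) (hC Λ)
    refine hmono.trans ?_
    rw [intervalIntegral.integral_const_mul, intervalIntegral.integral_const_mul, mul_left_comm]
    exact mul_le_mul_of_nonneg_left (hD Λ) (by positivity)
  -- The disorder term is linear in the scale, so f₂ is bounded by order N^(-1/4), against N^(-1/2)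
  -- for f₁.
  · have hlim : Tendsto (fun Λ : Box d => C * (KD * Λ.scale ^ 2 + KT * Λ.scale)) atTop (𝓝 0) := by
      simpa using (((hs.pow 2).const_mul KD).add (hs.const_mul KT)).const_mul C
    refine squeeze_zero (fun Λ => intervalIntegral.integral_nonneg hβ fun _ _ => abs_nonneg _)
      (fun Λ => ?_) hlim
    have hmono := intervalIntegral.integral_mono_on (μ := volume) hβ
      ((M.continuous_f₂ G Λ μ).abs.intervalIntegrable _ _)
      (((((hDc Λ).add (hTc Λ)).const_mul C).const_mul (Λ.vol)⁻¹).intervalIntegrable _ _)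
      fun β _ => M.abs_f₂_le β (hb Λ) (hC Λ)
    simp only [Pi.add_apply] at hmono
    refine hmono.trans ?_
    rw [intervalIntegral.integral_const_mul, intervalIntegral.integral_const_mul, mul_left_comm,
      intervalIntegral.integral_add ((hDc Λ).intervalIntegrable _ _)
        ((hTc Λ).intervalIntegrable _ _), mul_add]
    exact mul_le_mul_of_nonneg_left (add_le_add (hD Λ) (hT Λ)) hC0
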